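/- **Setting.** Let $p\ge 2$ be even and $N,n\ge 1$ integers ($n=n_{bos}$). A tensor $T$ of order $p$ and dimension $N$ has complex entries $T_{\mu_1,\dots,\mu_p}$, $\mu_a\in\{1,\dots,N\}$. On $(\mathbb C^N)^{\otimes n}$ define $$H(T)=\frac12\sum_{i_1,\dots,i_{p/2}}\Bigl(\sum_{\mu_1,\dots,\mu_p}T_{\mu_1,\dots,\mu_p}\,|\mu_1\rangle_{i_1}\langle\mu_{1+p/2}|\otimes\cdots\otimes|\mu_{p/2}\rangle_{i_{p/2}}\langle\mu_p|+\text{h.c.}\Bigr),$$ where the outer sum is over all ordered tuples of distinct $i_1,\dots,i_{p/2}\in\{1,\dots,n\}$, $|\mu\rangle_i\langle\nu|$ is the operator $|\mu\rangle\langle\nu|$ acting on the $i$-th tensor factor, and h.c. denotes the Hermitian conjugate of the preceding term. $H(T)$ preserves the symmetric subspace (the vectors invariant under permutation of the $n$ tensor factors), whose dimension is denoted $D(N,n)$; $\mathrm{tr}$ denotes the trace over this subspace. The random tensor $G$ is drawn from one of four ensembles. In the real ensemble the entries are independent real Gaussians with mean $0$ and variance $1$; in the complex ensemble the entries are independent,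 and their real and imaginary parts are independent Gaussians with mean $0$ and variance $1/2$. In either case one may replace $G$ by its symmetrization, i.e. $1/p!$ times the sum of the tensors obtained from $G$ by permuting the indices. For real $\tau$ let $$Z(\tau,p,N,n)=\mathbb E\bigl[\mathrm{tr}\,\exp(\tau H(G))\bigr].$$ **Lemma.** For every even $p\ge2$ there is $\theta>0$, depending only on $p$, such that for each of the four ensembles there are real numbers $J=J(p,N,n)$ with the following properties. 1. For all $N,n\ge1$ and all $\tau\in\mathbb R$, the random variable $\mathrm{tr}\,\exp(\tau H(G))$ is integrable and $$Z(\tau,p,N,n)\le D(N,n)\,\exp\Bigl(\tau^2\,\frac J2\,n^{p/2}N^{p/2}\Bigr).$$ 2. Let $\kappa=1$ for the real ensemble and $\kappa=2$ for the complex ensemble (symmetrized or not). For every choice of integers $n=n(N)\ge1$ with $n=O(N^\theta)$, $$J=\kappa\,\frac{(p/2)!\,\binom{n}{p/2}}{n^{p/2}}+o(1)\qquad(N\to\infty);$$ in particular, if moreover $n(N)\to\infty$, then $J\to\kappa$. -/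

import Mathlib

open MeasureTheory ProbabilityTheory Filter Topology Asymptotics
open scoped NNReal Matrix Nat

namespace SpikedTensor

noncomputable section

/-- A tensor of order `p` and dimension `N` with complex entries `T μ = T_{μ_1, …, μ_p}`. -/
abbrev Tensor (p N : ℕ) : Type := (Fin p → Fin N) → ℂ

/-- The symmetrization of a tensor: `1 / p!` times the sum of the tensors obtained by permuting
its indices. -/
def symmetrize {p N : ℕ} (T : Tensor p N) : Tensor p N :=
  fun μ => ((p ! : ℕ) : ℂ)⁻¹ * ∑ π : Equiv.Perm (Fin p), T (μ ∘ π)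

/-- Real or complex Gaussian entries. -/
inductive EntryField
  | real
  | complex

/-- The factor `1` (real ensemble) or `2` (complex ensemble) in the value of `J`. -/
def EntryField.factor : EntryField → ℝ
  | .real => 1
  | .complex => 2

/-- The law of a tensor with independent Gaussian entries, without symmetrization: real entries
of mean `0` and variance `1`, or complex entries whose real and imaginary parts are independent
Gaussians of mean `0` and variance `1 / 2`. -/
def gaussianTensor (p N : ℕ) : EntryField → Measure (Tensor p N)
  | .real =>
      (Measure.pi fun _ : Fin p → Fin N => gaussianReal 0 1).map
        fun g μ => ((g μ : ℝ) : ℂ)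
  | .complex =>
      (Measure.pi fun _ : Fin p → Fin N =>
          (gaussianReal 0 (1 / 2)).prod (gaussianReal 0 (1 / 2))).map
        fun g μ => ⟨(g μ).1, (g μ).2⟩

/-- The four ensembles: real or complex, symmetrized (`sym = true`) or not (`sym = false`). -/
def ensemble (p N : ℕ) (κ : EntryField) (sym : Bool) : Measure (Tensor p N) :=
  if sym then (gaussianTensor p N κ).map symmetrize else gaussianTensor p N κ

theorem isProbabilityMeasure_gaussianTensor (p N : ℕ) (κ : EntryField) :
    IsProbabilityMeasure (gaussianTensor p N κ) := by
  cases κ with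
  | real =>
    refine Measure.isProbabilityMeasure_map (Measurable.aemeasurable ?_)
    fun_prop
  | complex =>
    refine Measure.isProbabilityMeasure_map (Measurable.aemeasurable ?_)
    refine measurable_pi_lambda _ fun μ => ?_
    exact Complex.measurableEquivRealProd.symm.measurable.comp (measurable_pi_apply μ)

/-- Each ensemble is a probability measure on tensors. -/
theorem isProbabilityMeasure_ensemble (p N : ℕ) (κ : EntryField) (sym : Bool) :
    IsProbabilityMeasure (ensemble p N κ sym) := by
  have := isProbabilityMeasure_gaussianTensor p N κ
  unfold ensemble
  split_ifs
  · refine Measure.isProbabilityMeasure_map (Measurable.aemeasurable ?_)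
    unfold symmetrize
    fun_prop
  · exact this

/-- Operators on the full Hilbert space `(ℂ^N)^{⊗ n}`, as matrices in the product basis
`|α_1⟩ ⊗ … ⊗ |α_n⟩`, `α : Fin n → Fin N`. -/
abbrev Operator (N n : ℕ) : Type := Matrix (Fin n → Fin N) (Fin n → Fin N) ℂ

/-- The operator `⨂_a |μ_a⟩_{i_a} ⟨ν_a|`: it acts as `|μ_a⟩⟨ν_a|` on qudit `i_a` for every `a`, and
as the identity on all qudits outside the range of `i`. -/
def ketBra {N n k : ℕ} (i : Fin k ↪ Fin n) (μ ν : Fin k → Fin N) : Operator N n :=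
  Matrix.of fun α β =>
    open Classical in
    if (∀ a, α (i a) = μ a ∧ β (i a) = ν a) ∧ (∀ j, j ∉ Set.range i → α j = β j) then 1 else 0

/-- The first `p / 2` indices of a multi-index. -/
def firstHalf {p N : ℕ} (μ : Fin p → Fin N) : Fin (p / 2) → Fin N :=
  fun a => μ ⟨a, by omega⟩

/-- The last `p / 2` indices of a multi-index (for even `p`). -/
def lastHalf {p N : ℕ} (μ : Fin p → Fin N) : Fin (p / 2) → Fin N :=
  fun a => μ ⟨a + p / 2, by omega⟩

/-- `∑_μ T_μ |μ_1⟩_{i_1}⟨μ_{1+p/2}| ⊗ … ⊗ |μ_{p/2}⟩_{i_{p/2}}⟨μ_p|` for distinct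
qudits `i_1, …, i_{p/2}`. -/
def interaction {p N n : ℕ} (T : Tensor p N) (i : Fin (p / 2) ↪ Fin n) : Operator N n :=
  ∑ μ : Fin p → Fin N, T μ • ketBra i (firstHalf μ) (lastHalf μ)

/-- The Hamiltonian `H(T)` of a tensor of even order `p` on the full Hilbert space of `n` qudits of
dimension `N`; the sum is over all ordered choices of distinct qudits `i_1, …, i_{p/2}`. -/
def hamiltonian {p N : ℕ} (n : ℕ) (T : Tensor p N) : Operator N n :=
  (1 / 2 : ℂ) • ∑ i : Fin (p / 2) ↪ Fin n, (interaction T i + (interaction T i)ᴴ)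

/-- The symmetric subspace of the full Hilbert space: vectors that are invariant under permutation
of the `n` qudits. -/
def symSubspace (N n : ℕ) : Submodule ℂ ((Fin n → Fin N) → ℂ) where
  carrier := {ψ | ∀ (σ : Equiv.Perm (Fin n)) (α : Fin n → Fin N), ψ (α ∘ σ) = ψ α}
  add_mem' := by
    intro ψ χ hψ hχ σ α
    simp only [Pi.add_apply, hψ σ α, hχ σ α]
  zero_mem' := by
    intro σ α
    rfl
  smul_mem' := by
    intro c ψ hψ σ α
    simp only [Pi.smul_apply, hψ σ α]

/-- `D(N, n)`, the dimension of the symmetric subspace. -/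
def symDim (N n : ℕ) : ℕ := Module.finrank ℂ (symSubspace N n)

/-- The permutation of the product basis induced by a permutation of the qudits. -/
def permBasis (N : ℕ) {n : ℕ} (σ : Equiv.Perm (Fin n)) : (Fin n → Fin N) ≃ (Fin n → Fin N) :=
  σ.arrowCongr (Equiv.refl (Fin N))

theorem permBasis_symm_apply {N n : ℕ} (σ : Equiv.Perm (Fin n)) (α : Fin n → Fin N) :
    (permBasis N σ).symm α = α ∘ σ := rfl

theorem ketBra_perm {N n k : ℕ} (σ : Equiv.Perm (Fin n)) (i : Fin k ↪ Fin n)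
    (μ ν : Fin k → Fin N) (α β : Fin n → Fin N) :
    ketBra i μ ν (α ∘ σ) (β ∘ σ) = ketBra (i.trans σ.toEmbedding) μ ν α β := by
  have h : (∀ j, j ∉ Set.range i → (α ∘ σ) j = (β ∘ σ) j) ↔
      (∀ j, j ∉ Set.range (i.trans σ.toEmbedding) → α j = β j) := by
    constructor
    · intro h j hj
      have := h (σ.symm j) (by
        rintro ⟨a, ha⟩
        exact hj ⟨a, by simp [ha]⟩)
      simpa using this
    · intro h j hj
      refine h (σ j) ?_
      rintro ⟨a, ha⟩
      exact hj ⟨a, σ.injective (by simpa using ha)⟩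
  simp only [ketBra, Matrix.of_apply, h]
  rfl

theorem interaction_perm {p N n : ℕ} (σ : Equiv.Perm (Fin n)) (T : Tensor p N)
    (i : Fin (p / 2) ↪ Fin n) (α β : Fin n → Fin N) :
    interaction T i (α ∘ σ) (β ∘ σ) = interaction T (i.trans σ.toEmbedding) α β := by
  simp only [interaction, Matrix.sum_apply, Matrix.smul_apply, ketBra_perm]

theorem hamiltonian_perm {p N n : ℕ} (σ : Equiv.Perm (Fin n)) (T : Tensor p N)
    (α β : Fin n → Fin N) :
    hamiltonian n T (α ∘ σ) (β ∘ σ) = hamiltonian n T α β := by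
  simp only [hamiltonian, Matrix.smul_apply, Matrix.sum_apply, Matrix.add_apply,
    Matrix.conjTranspose_apply, interaction_perm]
  congr 1
  exact Fintype.sum_equiv (Equiv.embeddingCongr (Equiv.refl _) σ) _ _ (fun i => rfl)

/-- The Hamiltonian is Hermitian. -/
theorem hamiltonian_isHermitian {p N : ℕ} (n : ℕ) (T : Tensor p N) :
    (hamiltonian n T).IsHermitian := by
  ext α β
  simp only [hamiltonian, Matrix.conjTranspose_apply, Matrix.smul_apply, Matrix.sum_apply,
    Matrix.add_apply, smul_eq_mul, star_mul', star_sum, star_add, star_star]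
  rw [Finset.sum_congr rfl fun i _ => add_comm _ _]
  congr 1
  simp

/-- `exp (τ H(T))` on the full Hilbert space. -/
def expHamiltonian {p N : ℕ} (n : ℕ) (τ : ℝ) (T : Tensor p N) : Operator N n :=
  NormedSpace.exp ((τ : ℂ) • hamiltonian n T)

theorem expHamiltonian_perm {p N n : ℕ} (σ : Equiv.Perm (Fin n)) (τ : ℝ) (T : Tensor p N)
    (α β : Fin n → Fin N) :
    expHamiltonian n τ T (α ∘ σ) (β ∘ σ) = expHamiltonian n τ T α β := by
  have hH : (Matrix.reindexAlgEquiv ℂ ℂ (permBasis N σ)) ((τ : ℂ) • hamiltonian n T)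
      = (τ : ℂ) • hamiltonian n T := by
    ext α β
    simp only [Matrix.coe_reindexAlgEquiv, Matrix.reindex_apply, Matrix.submatrix_apply,
      permBasis_symm_apply, Matrix.smul_apply, hamiltonian_perm]
  have hE : (Matrix.reindexAlgEquiv ℂ ℂ (permBasis N σ)) (expHamiltonian n τ T)
      = expHamiltonian n τ T := by
    let _ : NormedRing (Operator N n) := Matrix.linftyOpNormedRing
    let _ : NormedAlgebra ℂ (Operator N n) := Matrix.linftyOpNormedAlgebra
    let _ : NormedAlgebra ℚ (Operator N n) := NormedAlgebra.restrictScalars ℚ ℂ _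
    have hc : Continuous (Matrix.reindexAlgEquiv ℂ ℂ (permBasis N σ)) :=
      continuous_id.matrix_reindex _ _
    have := NormedSpace.map_exp (Matrix.reindexAlgEquiv ℂ ℂ (permBasis N σ)) hc
      ((τ : ℂ) • hamiltonian n T)
    rw [hH] at this
    exact this
  exact congrFun (congrFun hE α) β

/-- `exp (τ H(T))` preserves the symmetric subspace. -/
theorem expHamiltonian_mapsTo {p N n : ℕ} (τ : ℝ) (T : Tensor p N) :
    ∀ ψ ∈ symSubspace N n, Matrix.toLin' (expHamiltonian n τ T) ψ ∈ symSubspace N n := by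
  intro ψ hψ σ α
  simp only [Matrix.toLin'_apply, Matrix.mulVec, dotProduct]
  refine (Fintype.sum_equiv (permBasis N σ).symm _ _ fun β => ?_).symm
  rw [permBasis_symm_apply, expHamiltonian_perm, hψ σ β]

/-- `tr (exp (τ H(T)))`, the trace being taken over the symmetric subspace. -/
def trExp {p N : ℕ} (n : ℕ) (τ : ℝ) (T : Tensor p N) : ℂ :=
  LinearMap.trace ℂ (symSubspace N n)
    ((Matrix.toLin' (expHamiltonian n τ T)).restrict (expHamiltonian_mapsTo τ T))

/-- `Z(τ, p, N, n) = 𝔼 [tr (exp (τ H(G)))]` for `G` drawn from the given ensemble. The trace is a real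
number, because `H(G)` is Hermitian. -/
def Z (κ : EntryField) (sym : Bool) (τ : ℝ) (p N n : ℕ) : ℝ :=
  ∫ G, (trExp n τ G).re ∂(ensemble p N κ sym)

/-- The leading value `(p/2)! (n choose p/2) / n^{p/2}` of `J` for the real ensemble. -/
def leadingJ (p n : ℕ) : ℝ :=
  (((p / 2)! : ℕ) : ℝ) * (n.choose (p / 2) : ℝ) / (n : ℝ) ^ (p / 2)

end

end SpikedTensor

/-!
The Hamiltonian is real-linear in the tensor, and each of the four ensembles is the law of a finite
series `∑ k, x k • t k` with fixed tensors `t k` and independent centred Gaussians `x k` of equal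
variance `v` (`exists_ensemble_eq_map`). So `H(G)` is a Gaussian series `H = ∑ k, x k • A k` of
Hermitian matrices, and two bounds are needed.

*Trace bound.* If `∑ k, A k ^ 2 ≤ w` and the projection `P` commutes with all `A k`, then
`𝔼 tr (P exp (τ H)) ≤ tr P * exp (τ ^ 2 * v * w / 2)` (`integral_trace_exp_series_le`). Here `P` is
the symmetrizer, whose trace is `D(N, n)`. Gaussian integration by parts turns
`𝔼 tr (P H ^ (2 t + 2))` into the sum over `k` and `q ≤ 2 t` of
`v * 𝔼 tr (P A_k H ^ q A_k H ^ (2 t - q))`. In an eigenbasis of `H` each of these traces is seen to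
increase if the two factors `A_k` are moved together (`trace_mul_pow_mul_pow_le`). Hence
`𝔼 tr (P H ^ (2 t + 2)) ≤ (2 t + 1) v w 𝔼 tr (P H ^ (2 t))`, so the even moments are at most those of a
Gaussian of variance `v w`, times `tr P`. Summing the series of `cosh` gives the claim, because `H`
and `-H` have the same law. Only moments of polynomials enter, so integration by parts is needed for
monomials in independent Gaussians alone.

*Operator bound.* Let `k = p / 2`, and let `K a b` be the sum of `|a⟩_i ⟨b|` over ordered choices `i` of
`k` distinct qudits. Without symmetrization the `A`'s are `(c K + (c K)ᴴ) / 2` with `|c| = 1`, and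
`((X + Xᴴ) / 2) ^ 2 ≤ (X Xᴴ + Xᴴ X) / 2`, so it suffices to bound `∑ a, ∑ b, K a b * K b a`. This matrix
is Hermitian, so it is bounded by its largest absolute row sum. The terms with the same choice of
qudits in both factors have row sums at most `N ^ k`, and there are
`n (n - 1) ⋯ (n - k + 1) = k! (n choose k)` of them; all other pairs of choices have row sums at most
`N ^ (k - 1)` (`card_agree_le`). Symmetrizing the tensor averages Hamiltonians, which does not
increase the sum of squares (`sq_average_le`).

Therefore `J = κ * (leadingJ + error)` is admissible with `0 ≤ error ≤ n ^ k / N`, and the error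
vanishes in the limit if `n = O(N ^ θ)` with `θ = 1 / (2 k)`.
-/

namespace SpikedTensor

/-! ### Gaussian integration by parts for polynomials -/

theorem integrable_pow_gaussianReal (v : ℝ≥0) (k : ℕ) :
    Integrable (fun x : ℝ => x ^ k) (gaussianReal 0 v) := by
  rcases Nat.eq_zero_or_pos k with rfl | hk
  · simp
  · have h := (memLp_id_gaussianReal (μ := 0) (v := v) (k : ℝ≥0)).integrable_norm_pow hk.ne'
    refine (integrable_norm_iff (by fun_prop)).1 ?_
    simpa [norm_pow] using h

theorem hasDerivAt_gaussianPDFReal (v : ℝ≥0) (x : ℝ) :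
    HasDerivAt (gaussianPDFReal 0 v) (-(x / v) * gaussianPDFReal 0 v x) x := by
  have h : HasDerivAt (fun x : ℝ => -(x - 0) ^ 2 / (2 * (v : ℝ))) (-(x / v)) x := by
    have := ((hasDerivAt_id x).sub_const 0 |>.pow 2).neg.div_const (2 * (v : ℝ))
    refine this.congr_deriv ?_
    simp only [id]
    ring
  rw [gaussianPDFReal_def]
  refine (h.exp.const_mul _).congr_deriv ?_
  ring

theorem integrable_pow_mul_gaussianPDFReal {v : ℝ≥0} (hv : v ≠ 0) (k : ℕ) :
    Integrable fun x : ℝ => x ^ k * gaussianPDFReal 0 v x := by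
  have h := integrable_pow_gaussianReal v k
  rw [gaussianReal_of_var_ne_zero _ hv,
    integrable_withDensity_iff_integrable_smul' (measurable_gaussianPDF 0 v)
      (ae_of_all _ fun _ => gaussianPDF_lt_top)] at h
  simpa [toReal_gaussianPDF, mul_comm] using h

/-- Gaussian integration by parts, for monomials in one variable. The case `k = 0` is the
vanishing of the mean. -/
theorem integral_pow_succ_gaussianReal (v : ℝ≥0) (k : ℕ) :
    ∫ x, x ^ (k + 1) ∂gaussianReal 0 v = v * (k * ∫ x, x ^ (k - 1) ∂gaussianReal 0 v) := by
  rcases eq_or_ne v 0 with rfl | hv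
  · simp
  have hv' : (v : ℝ) ≠ 0 := by exact_mod_cast hv
  have e (j : ℕ) : ∫ x, x ^ j ∂gaussianReal 0 v = ∫ x, x ^ j * gaussianPDFReal 0 v x := by
    rw [integral_gaussianReal_eq_integral_smul hv]
    simp [mul_comm]
  have key := integral_mul_deriv_eq_deriv_mul_of_integrable
    (u := fun x : ℝ => x ^ k) (u' := fun x => k * x ^ (k - 1)) (v := gaussianPDFReal 0 v)
    (v' := fun x => -(x / v) * gaussianPDFReal 0 v x)
    (fun x _ => hasDerivAt_pow k x) (fun x _ => hasDerivAt_gaussianPDFReal v x)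
    (by
      refine ((integrable_pow_mul_gaussianPDFReal hv (k + 1)).const_mul (-(v : ℝ)⁻¹)).congr
        (ae_of_all _ fun x => ?_)
      simp only [Pi.mul_apply]
      ring)
    (by
      refine ((integrable_pow_mul_gaussianPDFReal hv (k - 1)).const_mul (k : ℝ)).congr
        (ae_of_all _ fun x => ?_)
      simp only [Pi.mul_apply]
      ring)
    (integrable_pow_mul_gaussianPDFReal hv k)
  have h1 : ∫ x : ℝ, x ^ k * (-(x / v) * gaussianPDFReal 0 v x)
      = -(v : ℝ)⁻¹ * ∫ x, x ^ (k + 1) * gaussianPDFReal 0 v x := by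
    rw [← integral_const_mul]
    congr 1
    ext x
    ring
  have h2 : ∫ x : ℝ, k * x ^ (k - 1) * gaussianPDFReal 0 v x
      = k * ∫ x, x ^ (k - 1) * gaussianPDFReal 0 v x := by
    rw [← integral_const_mul]
    congr 1
    ext x
    ring
  rw [h1, h2] at key
  rw [e, e]
  field_simp at key
  linarith

section Polynomial

variable {ι : Type*}

/-- The evaluation of a complex polynomial at a real point. -/
noncomputable def evalReal (x : ι → ℝ) : MvPolynomial ι ℂ →+* ℂ :=
  MvPolynomial.eval fun k => (x k : ℂ)

theorem evalReal_X (x : ι → ℝ) (k : ι) : evalReal x (MvPolynomial.X k) = x k := by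
  simp [evalReal]

theorem evalReal_C (x : ι → ℝ) (c : ℂ) : evalReal x (MvPolynomial.C c) = c := by
  simp [evalReal]

variable [Fintype ι]

theorem evalReal_monomial (x : ι → ℝ) (m : ι →₀ ℕ) (c : ℂ) :
    evalReal x (MvPolynomial.monomial m c) = c * ((∏ k, x k ^ m k : ℝ) : ℂ) := by
  rw [evalReal, MvPolynomial.eval_monomial, Finsupp.prod_fintype _ _ (by simp)]
  simp

theorem integrable_evalReal (v : ℝ≥0) (F : MvPolynomial ι ℂ) :
    Integrable (fun x => evalReal x F) (Measure.pi fun _ : ι => gaussianReal 0 v) := by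
  induction F using MvPolynomial.induction_on' with
  | monomial m c =>
    simp only [evalReal_monomial]
    refine Integrable.const_mul (Integrable.ofReal ?_) _
    exact Integrable.fintype_prod fun k => integrable_pow_gaussianReal v (m k)
  | add F G hF hG =>
    simp only [map_add]
    exact hF.add hG

theorem integrable_mul_evalReal (v : ℝ≥0) (k : ι) (F : MvPolynomial ι ℂ) :
    Integrable (fun x : ι → ℝ => (x k : ℂ) * evalReal x F)
      (Measure.pi fun _ : ι => gaussianReal 0 v) := by
  refine (integrable_evalReal v (MvPolynomial.X k * F)).congr (ae_of_all _ fun x => ?_)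
  change evalReal x (MvPolynomial.X k * F) = (x k : ℂ) * evalReal x F
  rw [map_mul, evalReal_X]

/-- Gaussian integration by parts for polynomials in independent Gaussians. -/
theorem integral_mul_evalReal (v : ℝ≥0) (k : ι) (F : MvPolynomial ι ℂ) :
    ∫ x, (x k : ℂ) * evalReal x F ∂(Measure.pi fun _ : ι => gaussianReal 0 v)
      = v * ∫ x, evalReal x (MvPolynomial.pderiv k F)
          ∂(Measure.pi fun _ : ι => gaussianReal 0 v) := by
  classical
  induction F using MvPolynomial.induction_on' with
  | monomial m c =>
    have h1 (x : ι → ℝ) : (x k : ℂ) * evalReal x (MvPolynomial.monomial m c)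
        = c * ((∏ j, x j ^ ((m + Finsupp.single k 1 : ι →₀ ℕ) j) : ℝ) : ℂ) := by
      have : ∏ j, x j ^ ((m + Finsupp.single k 1 : ι →₀ ℕ) j) = x k * ∏ j, x j ^ m j := by
        simp only [Finsupp.add_apply, pow_add, Finset.prod_mul_distrib]
        rw [mul_comm, Finset.prod_eq_single k (by
          intro j _ hj
          simp [hj.symm]) (by simp)]
        simp
      rw [evalReal_monomial, this]
      push_cast
      ring
    simp only [h1]
    simp only [MvPolynomial.pderiv_monomial, evalReal_monomial, integral_const_mul]
    rw [integral_complex_ofReal, integral_complex_ofReal,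
      integral_fintype_prod_eq_prod
        (f := fun j (y : ℝ) => y ^ ((m + Finsupp.single k 1 : ι →₀ ℕ) j)),
      integral_fintype_prod_eq_prod
        (f := fun j (y : ℝ) => y ^ ((m - Finsupp.single k 1 : ι →₀ ℕ) j)),
      ← Finset.mul_prod_erase _ _ (Finset.mem_univ k),
      ← Finset.mul_prod_erase _ _ (Finset.mem_univ k)]
    have h2 : ∏ j ∈ Finset.univ.erase k,
          ∫ y, y ^ ((m + Finsupp.single k 1 : ι →₀ ℕ) j) ∂gaussianReal 0 v
        = ∏ j ∈ Finset.univ.erase k,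
          ∫ y, y ^ ((m - Finsupp.single k 1 : ι →₀ ℕ) j) ∂gaussianReal 0 v := by
      refine Finset.prod_congr rfl fun j hj => ?_
      have hj' : k ≠ j := (Finset.ne_of_mem_erase hj).symm
      simp [hj']
    rw [h2]
    have h3 := integral_pow_succ_gaussianReal v (m k)
    simp only [Finsupp.add_apply, Finsupp.single_eq_same, Finsupp.tsub_apply, h3]
    push_cast
    ring
  | add F G hF hG =>
    simp only [map_add, mul_add]
    rw [integral_add (integrable_mul_evalReal v k F) (integrable_mul_evalReal v k G), hF, hG,
      integral_add (integrable_evalReal v _) (integrable_evalReal v _), mul_add]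

end Polynomial

/-! ### A trace inequality for Hermitian matrices -/

section TraceInequality

open scoped ComplexOrder

variable {m : Type*} [Fintype m] [DecidableEq m]

/-- For even `q + s` the function `a ^ q * b ^ s + a ^ s * b ^ q` is at most
`a ^ (q + s) + b ^ (q + s)`, because `|a| ^ q - |b| ^ q` and `|a| ^ s - |b| ^ s` have the same
sign. -/
theorem pow_mul_pow_add_le (a b : ℝ) {q s : ℕ} (h : Even (q + s)) :
    a ^ q * b ^ s + a ^ s * b ^ q ≤ a ^ (q + s) + b ^ (q + s) := by
  have e (x y : ℝ) : x ^ q * y ^ s ≤ |x| ^ q * |y| ^ s := by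
    rw [← abs_pow, ← abs_pow, ← abs_mul]
    exact le_abs_self _
  have h1 : 0 ≤ (|a| ^ q - |b| ^ q) * (|a| ^ s - |b| ^ s) := by
    rcases le_total |a| |b| with hab | hab
    · exact mul_nonneg_of_nonpos_of_nonpos
        (sub_nonpos.2 (pow_le_pow_left₀ (abs_nonneg _) hab q))
        (sub_nonpos.2 (pow_le_pow_left₀ (abs_nonneg _) hab s))
    · exact mul_nonneg (sub_nonneg.2 (pow_le_pow_left₀ (abs_nonneg _) hab q))
        (sub_nonneg.2 (pow_le_pow_left₀ (abs_nonneg _) hab s))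
  have h2 := e a b
  have h3 := e b a
  rw [← h.pow_abs a, ← h.pow_abs b, pow_add, pow_add]
  nlinarith

/-- Moving the two copies of `B` together does not decrease the trace. In an eigenbasis of `H` both
sides are sums of `|B i j| ^ 2` against functions of the eigenvalues, and after symmetrization in `i`
and `j` the inequality holds term by term. -/
theorem trace_mul_pow_mul_pow_le {H B : Matrix m m ℂ} (hH : H.IsHermitian) (hB : B.IsHermitian)
    {q s : ℕ} (h : Even (q + s)) :
    (B * H ^ q * B * H ^ s).trace.re ≤ (B * B * H ^ (q + s)).trace.re := by
  set U : Matrix m m ℂ := (hH.eigenvectorUnitary).1 with hU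
  have hU1 : star U * U = 1 := Unitary.coe_star_mul_self _
  have hU2 : U * star U = 1 := Unitary.coe_mul_star_self _
  set d : m → ℝ := hH.eigenvalues
  have hHd : H = U * Matrix.diagonal (fun i => (d i : ℂ)) * star U := by
    have := hH.spectral_theorem
    rwa [Unitary.conjStarAlgAut_apply] at this
  have hpow (r : ℕ) : H ^ r = U * Matrix.diagonal (fun i => ((d i ^ r : ℝ) : ℂ)) * star U := by
    induction r with
    | zero => simp [hU2]
    | succ r ih =>
      rw [pow_succ, ih, hHd]
      calc U * Matrix.diagonal (fun i => ((d i ^ r : ℝ) : ℂ)) * star U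
            * (U * Matrix.diagonal (fun i => (d i : ℂ)) * star U)
          = U * Matrix.diagonal (fun i => ((d i ^ r : ℝ) : ℂ)) * (star U * U)
            * Matrix.diagonal (fun i => (d i : ℂ)) * star U := by simp only [mul_assoc]
        _ = _ := by
          rw [hU1, mul_one, mul_assoc U, Matrix.diagonal_mul_diagonal]
          simp [pow_succ]
  set C : Matrix m m ℂ := star U * B * U with hC
  have hCH : C.IsHermitian := by
    rw [hC]
    exact Matrix.isHermitian_conjTranspose_mul_mul U hB
  have htr (a b : ℕ) : (B * H ^ a * B * H ^ b).trace.re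
      = ∑ i, ∑ j, Complex.normSq (C i j) * (d j ^ a * d i ^ b) := by
    have e1 : (B * H ^ a * B * H ^ b).trace
        = (C * Matrix.diagonal (fun i => ((d i ^ a : ℝ) : ℂ)) *
          (C * Matrix.diagonal (fun i => ((d i ^ b : ℝ) : ℂ)))).trace := by
      rw [hpow, hpow, hC, ← mul_assoc _ (U * _) (star U), Matrix.trace_mul_comm]
      simp only [mul_assoc]
    rw [e1, Matrix.trace, Complex.re_sum]
    refine Finset.sum_congr rfl fun i _ => ?_
    rw [Matrix.diag_apply, Matrix.mul_apply, Complex.re_sum]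
    refine Finset.sum_congr rfl fun j _ => ?_
    rw [Matrix.mul_diagonal, Matrix.mul_diagonal, ← hCH.apply j i, Complex.star_def]
    have : C i j * ((d j ^ a : ℝ) : ℂ) * ((starRingEnd ℂ) (C i j) * ((d i ^ b : ℝ) : ℂ))
        = ((Complex.normSq (C i j) * (d j ^ a * d i ^ b) : ℝ) : ℂ) := by
      rw [Complex.ofReal_mul, Complex.normSq_eq_conj_mul_self]
      push_cast
      ring
    rw [this, Complex.ofReal_re]
  -- Exchanging the two summation indices exchanges the exponents.
  have hsymm (a b : ℕ) : ∑ i, ∑ j, Complex.normSq (C i j) * (d j ^ a * d i ^ b)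
      = ∑ i, ∑ j, Complex.normSq (C i j) * (d j ^ b * d i ^ a) := by
    rw [Finset.sum_comm]
    refine Finset.sum_congr rfl fun i _ => Finset.sum_congr rfl fun j _ => ?_
    rw [← hCH.apply j i, Complex.star_def, Complex.normSq_conj]
    ring
  have h0 := htr 0 (q + s)
  rw [pow_zero, mul_one] at h0
  rw [h0, htr q s]
  have h1 := hsymm q s
  have h2 := hsymm 0 (q + s)
  have h3 : ∑ i, ∑ j, Complex.normSq (C i j) * (d j ^ q * d i ^ s)
        + ∑ i, ∑ j, Complex.normSq (C i j) * (d j ^ s * d i ^ q)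
      ≤ ∑ i, ∑ j, Complex.normSq (C i j) * (d j ^ 0 * d i ^ (q + s))
        + ∑ i, ∑ j, Complex.normSq (C i j) * (d j ^ (q + s) * d i ^ 0) := by
    simp only [← Finset.sum_add_distrib]
    refine Finset.sum_le_sum fun i _ => Finset.sum_le_sum fun j _ => ?_
    have := mul_le_mul_of_nonneg_left (pow_mul_pow_add_le (d j) (d i) h)
      (Complex.normSq_nonneg (C i j))
    simp only [pow_zero, one_mul, mul_one]
    linarith
  linarith

theorem trace_mul_even_pow_nonneg {H X : Matrix m m ℂ} (hH : H.IsHermitian) (hX : X.PosSemidef)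
    {r : ℕ} (hr : Even r) : 0 ≤ (X * H ^ r).trace.re := by
  obtain ⟨t, rfl⟩ := hr
  have h := (hX.conjTranspose_mul_mul_same (H ^ t)).trace_nonneg
  rw [(hH.pow t).eq] at h
  have e : (X * H ^ (t + t)).trace = (H ^ t * X * H ^ t).trace := by
    rw [pow_add, ← mul_assoc, Matrix.trace_mul_comm, ← mul_assoc]
  rw [e]
  exact (Complex.le_def.1 h).1

end TraceInequality

/-! ### Integration by parts for the moments of a Gaussian matrix series -/

section MatrixPolynomial

variable {ι m : Type*}

theorem map_pderiv_map_C (k : ι) (Q : Matrix m m ℂ) :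
    (Q.map (MvPolynomial.C : ℂ →+* MvPolynomial ι ℂ)).map (MvPolynomial.pderiv k) = 0 := by
  ext1 i j
  simp

section Series

variable [Fintype ι]

/-- The Gaussian matrix series `∑ k, x k • A k`, at a point `x` of the sample space. -/
def series (A : ι → Matrix m m ℂ) (x : ι → ℝ) : Matrix m m ℂ :=
  ∑ k, (x k : ℂ) • A k

/-- The matrix series with polynomial entries whose evaluation at `x` is `series A x`. -/
noncomputable def polySeries (A : ι → Matrix m m ℂ) : Matrix m m (MvPolynomial ι ℂ) :=
  ∑ k, (MvPolynomial.X k : MvPolynomial ι ℂ) • (A k).map (MvPolynomial.C : ℂ →+* MvPolynomial ι ℂ)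

theorem map_pderiv_polySeries (A : ι → Matrix m m ℂ) (k : ι) :
    (polySeries A).map (MvPolynomial.pderiv k) = (A k).map MvPolynomial.C := by
  classical
  ext1 i j
  simp only [polySeries, Matrix.map_apply, Matrix.sum_apply, Matrix.smul_apply, smul_eq_mul,
    map_sum, Derivation.leibniz, MvPolynomial.pderiv_C, mul_zero, zero_add,
    MvPolynomial.pderiv_X, Pi.single_apply]
  simp

end Series

variable [Fintype m]

theorem map_pderiv_mul (k : ι) (M N : Matrix m m (MvPolynomial ι ℂ)) :
    (M * N).map (MvPolynomial.pderiv k)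
      = M.map (MvPolynomial.pderiv k) * N + M * N.map (MvPolynomial.pderiv k) := by
  ext1 i j
  simp only [Matrix.map_apply, Matrix.mul_apply, Matrix.add_apply, map_sum, Derivation.leibniz,
    smul_eq_mul, ← Finset.sum_add_distrib]
  refine Finset.sum_congr rfl fun l _ => ?_
  ring

theorem trace_map_pderiv (k : ι) (M : Matrix m m (MvPolynomial ι ℂ)) :
    (M.map (MvPolynomial.pderiv k)).trace = MvPolynomial.pderiv k M.trace := by
  simp [Matrix.trace]

variable [DecidableEq m]

theorem mapMatrix_evalReal_map_C (Q : Matrix m m ℂ) (x : ι → ℝ) :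
    (evalReal x).mapMatrix (Q.map MvPolynomial.C) = Q := by
  ext1 i j
  simp only [RingHom.mapMatrix_apply, Matrix.map_apply, evalReal_C]

variable [Fintype ι]

theorem mapMatrix_evalReal_polySeries (A : ι → Matrix m m ℂ) (x : ι → ℝ) :
    (evalReal x).mapMatrix (polySeries A) = series A x := by
  ext1 i j
  simp only [polySeries, series, RingHom.mapMatrix_apply, Matrix.map_apply, Matrix.sum_apply,
    Matrix.smul_apply, smul_eq_mul, map_sum, map_mul, evalReal_X, evalReal_C]

/-- The Leibniz rule for powers of a matrix, with the noncommuting factors kept in order. -/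
theorem map_pderiv_polySeries_pow (A : ι → Matrix m m ℂ) (k : ι) (r : ℕ) :
    (polySeries A ^ r).map (MvPolynomial.pderiv k)
      = ∑ q ∈ Finset.range r,
          polySeries A ^ q * (A k).map MvPolynomial.C * polySeries A ^ (r - 1 - q) := by
  induction r with
  | zero =>
    ext1 i j
    rw [pow_zero, Matrix.map_apply, Finset.sum_range_zero, Matrix.zero_apply, Matrix.one_apply]
    split_ifs
    · exact Derivation.map_one_eq_zero _
    · exact map_zero _
  | succ r ih =>
    rw [pow_succ, map_pderiv_mul, ih, map_pderiv_polySeries, Finset.sum_range_succ,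
      Finset.sum_mul]
    refine congrArg₂ (· + ·) (Finset.sum_congr rfl fun q hq => ?_) ?_
    · have e : r + 1 - 1 - q = (r - 1 - q) + 1 := by
        have := Finset.mem_range.1 hq
        omega
      rw [e, pow_succ _ (r - 1 - q), Matrix.mul_assoc _ _ (polySeries A)]
    · rw [Nat.add_sub_cancel, Nat.sub_self, pow_zero, Matrix.mul_one]

theorem trace_mul_series_pow_eq (A : ι → Matrix m m ℂ) (Q : Matrix m m ℂ) (r : ℕ) (x : ι → ℝ) :
    (Q * series A x ^ r).trace
      = evalReal x (Q.map MvPolynomial.C * polySeries A ^ r).trace := by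
  have h : (evalReal x).mapMatrix (Q.map MvPolynomial.C * polySeries A ^ r)
      = Q * series A x ^ r := by
    rw [map_mul, map_pow, mapMatrix_evalReal_polySeries, mapMatrix_evalReal_map_C]
  rw [← h, AddMonoidHom.map_trace, RingHom.mapMatrix_apply]

theorem integrable_trace_mul_series_pow (v : ℝ≥0) (A : ι → Matrix m m ℂ) (Q : Matrix m m ℂ)
    (r : ℕ) :
    Integrable (fun x => (Q * series A x ^ r).trace)
      (Measure.pi fun _ : ι => gaussianReal 0 v) := by
  simp only [trace_mul_series_pow_eq]
  exact integrable_evalReal v _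

/-- Gaussian integration by parts for the moments of a matrix series. -/
theorem integral_trace_mul_series_pow_succ (v : ℝ≥0) (A : ι → Matrix m m ℂ) (Q : Matrix m m ℂ)
    (r : ℕ) :
    ∫ x, (Q * series A x ^ (r + 1)).trace ∂(Measure.pi fun _ : ι => gaussianReal 0 v)
      = v * ∑ k, ∑ q ∈ Finset.range r,
          ∫ x, (Q * A k * series A x ^ q * A k * series A x ^ (r - 1 - q)).trace
            ∂(Measure.pi fun _ : ι => gaussianReal 0 v) := by
  have h1 (x : ι → ℝ) : (Q * series A x ^ (r + 1)).trace
      = ∑ k, (x k : ℂ) * evalReal x ((Q * A k).map MvPolynomial.C * polySeries A ^ r).trace := by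
    rw [pow_succ', ← mul_assoc]
    nth_rw 1 [series]
    rw [Finset.mul_sum, Finset.sum_mul, Matrix.trace_sum]
    refine Finset.sum_congr rfl fun k _ => ?_
    rw [← trace_mul_series_pow_eq, Matrix.mul_smul, Matrix.smul_mul, Matrix.trace_smul, smul_eq_mul]
  have h2 (k : ι) :
      MvPolynomial.pderiv k ((Q * A k).map MvPolynomial.C * polySeries A ^ r).trace
      = ∑ q ∈ Finset.range r, ((Q * A k).map MvPolynomial.C *
          (polySeries A ^ q * (A k).map MvPolynomial.C * polySeries A ^ (r - 1 - q))).trace := by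
    rw [← trace_map_pderiv, map_pderiv_mul, map_pderiv_map_C, Matrix.zero_mul, zero_add,
      map_pderiv_polySeries_pow, Finset.mul_sum, Matrix.trace_sum]
  have h3 (k : ι) (q : ℕ) (x : ι → ℝ) :
      evalReal x ((Q * A k).map MvPolynomial.C *
          (polySeries A ^ q * (A k).map MvPolynomial.C * polySeries A ^ (r - 1 - q))).trace
      = (Q * A k * series A x ^ q * A k * series A x ^ (r - 1 - q)).trace := by
    have h : (evalReal x).mapMatrix ((Q * A k).map MvPolynomial.C *
          (polySeries A ^ q * (A k).map MvPolynomial.C * polySeries A ^ (r - 1 - q)))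
        = Q * A k * series A x ^ q * A k * series A x ^ (r - 1 - q) := by
      simp only [map_mul, map_pow, mapMatrix_evalReal_polySeries, mapMatrix_evalReal_map_C,
        mul_assoc]
    rw [← h, AddMonoidHom.map_trace, RingHom.mapMatrix_apply]
  simp only [h1]
  rw [integral_finsetSum _ fun k _ => integrable_mul_evalReal v k _, Finset.mul_sum]
  refine Finset.sum_congr rfl fun k _ => ?_
  rw [integral_mul_evalReal, h2]
  congr 1
  simp only [map_sum, h3]
  refine integral_finsetSum _ fun q _ => ?_
  simp only [← h3]
  exact integrable_evalReal v _

end MatrixPolynomial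

/-! ### Moments of a Gaussian matrix series -/

section MomentBound

open scoped ComplexOrder

variable {ι m : Type*} [Fintype ι]

theorem isHermitian_series {A : ι → Matrix m m ℂ} (hA : ∀ k, (A k).IsHermitian) (x : ι → ℝ) :
    (series A x).IsHermitian := by
  rw [Matrix.IsHermitian, series, Matrix.conjTranspose_sum]
  refine Finset.sum_congr rfl fun k _ => ?_
  rw [Matrix.conjTranspose_smul, (hA k).eq, Complex.star_def, Complex.conj_ofReal]

variable [Fintype m]

theorem isHermitian_mul_of_commute {P B : Matrix m m ℂ} (hP : P.IsHermitian) (hB : B.IsHermitian)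
    (h : Commute P B) : (P * B).IsHermitian := by
  rw [Matrix.IsHermitian, Matrix.conjTranspose_mul, hP.eq, hB.eq, h.eq]

variable [DecidableEq m]

theorem commute_series {P : Matrix m m ℂ} {A : ι → Matrix m m ℂ} (hPA : ∀ k, Commute P (A k))
    (x : ι → ℝ) : Commute P (series A x) :=
  Commute.sum_right _ _ _ fun k _ => (hPA k).smul_right _

/-- The integrand produced by Gaussian integration by parts from the moment of order `2 * t + 2` is
at most `(2 * t + 1) * w` times the integrand of the moment of order `2 * t`. -/
theorem sum_trace_series_le {P : Matrix m m ℂ} {A : ι → Matrix m m ℂ} (hP : P.IsHermitian)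
    (hPP : P * P = P) (hA : ∀ k, (A k).IsHermitian) (hPA : ∀ k, Commute P (A k)) {w : ℝ}
    (hw : ((w : ℂ) • (1 : Matrix m m ℂ) - ∑ k, A k * A k).PosSemidef) (t : ℕ) (x : ι → ℝ) :
    ∑ k, ∑ q ∈ Finset.range (2 * t + 1),
        (P * A k * series A x ^ q * A k * series A x ^ (2 * t - q)).trace.re
      ≤ (2 * t + 1) * (w * (P * series A x ^ (2 * t)).trace.re) := by
  set H := series A x with hHdef
  have hH : H.IsHermitian := isHermitian_series hA x
  have hPH : Commute P H := commute_series hPA x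
  have h1 (k : ι) (q : ℕ) (hq : q ∈ Finset.range (2 * t + 1)) :
      (P * A k * H ^ q * A k * H ^ (2 * t - q)).trace.re
        ≤ (P * A k * (P * A k) * H ^ (2 * t)).trace.re := by
    have hq' : q + (2 * t - q) = 2 * t := by
      have := Finset.mem_range.1 hq
      omega
    -- A second copy of `P` is inserted, so that the inequality applies to the matrix `P * A k`.
    have e : P * A k * H ^ q * A k = P * A k * H ^ q * (P * A k) := by
      have : Commute P (A k * H ^ q) := (hPA k).mul_right (hPH.pow_right q)
      calc P * A k * H ^ q * A k = P * P * (A k * H ^ q) * A k := by rw [hPP]; simp only [mul_assoc]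
        _ = P * (A k * H ^ q * P) * A k := by rw [mul_assoc P P, this.eq]
        _ = _ := by simp only [mul_assoc]
    have := trace_mul_pow_mul_pow_le hH (isHermitian_mul_of_commute hP (hA k) (hPA k))
      (q := q) (s := 2 * t - q) (by rw [hq']; exact even_two_mul t)
    rwa [hq', ← e] at this
  have h2 : (∑ k, P * A k * (P * A k)) = P * (∑ k, A k * A k) * P := by
    rw [Finset.mul_sum, Finset.sum_mul]
    refine Finset.sum_congr rfl fun k _ => ?_
    rw [mul_assoc, ← mul_assoc (A k) P, ← (hPA k).eq, mul_assoc P (A k) (A k), ← mul_assoc P P,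
      hPP, mul_assoc, ← ((hPA k).mul_right (hPA k)).eq, ← mul_assoc P P, hPP]
  have h3 : (((w : ℂ) • P - ∑ k, P * A k * (P * A k))).PosSemidef := by
    have := hw.conjTranspose_mul_mul_same P
    rwa [hP.eq, mul_sub, sub_mul, Matrix.mul_smul, Matrix.smul_mul, mul_one, hPP, ← h2] at this
  have h4 := trace_mul_even_pow_nonneg hH h3 (even_two_mul t)
  rw [sub_mul, Matrix.trace_sub, Complex.sub_re, Matrix.smul_mul, Matrix.trace_smul, smul_eq_mul,
    Complex.re_ofReal_mul, Finset.sum_mul, Matrix.trace_sum, Complex.re_sum] at h4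
  calc ∑ k, ∑ q ∈ Finset.range (2 * t + 1), (P * A k * H ^ q * A k * H ^ (2 * t - q)).trace.re
      ≤ ∑ k, ∑ _q ∈ Finset.range (2 * t + 1), (P * A k * (P * A k) * H ^ (2 * t)).trace.re :=
        Finset.sum_le_sum fun k _ => Finset.sum_le_sum fun q hq => h1 k q hq
    _ = (2 * t + 1) * ∑ k, (P * A k * (P * A k) * H ^ (2 * t)).trace.re := by
        simp [Finset.mul_sum]
    _ ≤ _ := mul_le_mul_of_nonneg_left (by linarith) (by positivity)

/-- The trace moments of a Gaussian matrix series grow at most like the moments of a Gaussian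
variable of variance `v * w`. -/
theorem integral_trace_series_pow_le (v : ℝ≥0) {P : Matrix m m ℂ} {A : ι → Matrix m m ℂ}
    (hP : P.IsHermitian) (hPP : P * P = P) (hA : ∀ k, (A k).IsHermitian)
    (hPA : ∀ k, Commute P (A k)) {w : ℝ} (hw0 : 0 ≤ w)
    (hw : ((w : ℂ) • (1 : Matrix m m ℂ) - ∑ k, A k * A k).PosSemidef) (t : ℕ) :
    ∫ x, (P * series A x ^ (2 * t)).trace.re ∂(Measure.pi fun _ : ι => gaussianReal 0 v)
      ≤ (2 * t)! / (2 ^ t * t !) * (v * w) ^ t * P.trace.re := by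
  have hre {F : (ι → ℝ) → ℂ} (hF : Integrable F (Measure.pi fun _ : ι => gaussianReal 0 v)) :
      ∫ x, (F x).re ∂(Measure.pi fun _ : ι => gaussianReal 0 v)
        = (∫ x, F x ∂(Measure.pi fun _ : ι => gaussianReal 0 v)).re := integral_re hF
  have hsummand (k : ι) (a b : ℕ) : Integrable
      (fun x => (P * A k * series A x ^ a * A k * series A x ^ b).trace)
      (Measure.pi fun _ : ι => gaussianReal 0 v) := by
    have h (x : ι → ℝ) : (P * A k * series A x ^ a * A k * series A x ^ b).trace
        = evalReal x ((P * A k).map MvPolynomial.C * polySeries A ^ a * (A k).map MvPolynomial.C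
            * polySeries A ^ b).trace := by
      have h : (evalReal x).mapMatrix ((P * A k).map MvPolynomial.C * polySeries A ^ a
            * (A k).map MvPolynomial.C * polySeries A ^ b)
          = P * A k * series A x ^ a * A k * series A x ^ b := by
        simp only [map_mul, map_pow, mapMatrix_evalReal_polySeries, mapMatrix_evalReal_map_C]
      rw [← h, AddMonoidHom.map_trace, RingHom.mapMatrix_apply]
    simp only [h]
    exact integrable_evalReal v _
  have hsummand' (k : ι) (a b : ℕ) : Integrable
      (fun x => (P * A k * series A x ^ a * A k * series A x ^ b).trace.re)
      (Measure.pi fun _ : ι => gaussianReal 0 v) := (hsummand k a b).re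
  induction t with
  | zero => simp
  | succ t ih =>
    have h1 : ∫ x, (P * series A x ^ (2 * (t + 1))).trace.re
          ∂(Measure.pi fun _ : ι => gaussianReal 0 v)
        = v * ∫ x, ∑ k, ∑ q ∈ Finset.range (2 * t + 1),
            (P * A k * series A x ^ q * A k * series A x ^ (2 * t - q)).trace.re
            ∂(Measure.pi fun _ : ι => gaussianReal 0 v) := by
      rw [hre (integrable_trace_mul_series_pow v A P _),
        show 2 * (t + 1) = 2 * t + 1 + 1 by ring, integral_trace_mul_series_pow_succ]
      have : (v : ℂ) = ((v : ℝ) : ℂ) := rfl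
      rw [this, Complex.re_ofReal_mul, Complex.re_sum,
        integral_finsetSum _ fun k _ => integrable_finsetSum _ fun q _ => hsummand' k q _]
      congr 1
      refine Finset.sum_congr rfl fun k _ => ?_
      rw [Complex.re_sum, integral_finsetSum _ fun q _ => hsummand' k q _]
      refine Finset.sum_congr rfl fun q _ => ?_
      exact (hre (hsummand k q _)).symm
    have h2 : ∫ x, ∑ k, ∑ q ∈ Finset.range (2 * t + 1),
            (P * A k * series A x ^ q * A k * series A x ^ (2 * t - q)).trace.re
            ∂(Measure.pi fun _ : ι => gaussianReal 0 v)
        ≤ (2 * t + 1) * (w * ∫ x, (P * series A x ^ (2 * t)).trace.re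
            ∂(Measure.pi fun _ : ι => gaussianReal 0 v)) := by
      rw [← integral_const_mul, ← integral_const_mul]
      refine integral_mono
        (integrable_finsetSum _ fun k _ => integrable_finsetSum _ fun q _ => hsummand' k q _)
        (((integrable_trace_mul_series_pow v A P _).re.const_mul _).const_mul _)
        fun x => sum_trace_series_le hP hPP hA hPA hw t x
    rw [h1]
    calc (v : ℝ) * _ ≤ v * ((2 * t + 1) * (w * ((2 * t)! / (2 ^ t * t !) * (v * w) ^ t
            * P.trace.re))) := by
          refine mul_le_mul_of_nonneg_left (h2.trans ?_) v.2
          gcongr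
      _ = _ := by
          rw [show 2 * (t + 1) = 2 * t + 1 + 1 by ring, Nat.factorial_succ (2 * t + 1),
            Nat.factorial_succ (2 * t), Nat.factorial_succ t]
          push_cast
          field_simp
          ring

end MomentBound

/-! ### The trace exponential of a Gaussian matrix series -/

section TraceExp

open scoped ComplexOrder

variable {m : Type*} [Fintype m] [DecidableEq m]

theorem isHermitian_exp_smul {H : Matrix m m ℂ} (hH : H.IsHermitian) (τ : ℝ) :
    (NormedSpace.exp ((τ : ℂ) • H)).IsHermitian := by
  refine Matrix.IsHermitian.exp ?_
  rw [Matrix.IsHermitian, Matrix.conjTranspose_smul, hH.eq, Complex.star_def, Complex.conj_ofReal]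

theorem trace_mul_exp_im {P H : Matrix m m ℂ} (hP : P.IsHermitian) (hH : H.IsHermitian) (τ : ℝ) :
    (P * NormedSpace.exp ((τ : ℂ) • H)).trace.im = 0 := by
  rw [← Complex.conj_eq_iff_im, ← Complex.star_def, ← Matrix.trace_conjTranspose,
    Matrix.conjTranspose_mul, hP.eq, (isHermitian_exp_smul hH τ).eq, Matrix.trace_mul_comm]

theorem trace_mul_exp_nonneg {P H : Matrix m m ℂ} (hP : P.PosSemidef) (hH : H.IsHermitian)
    (τ : ℝ) : 0 ≤ (P * NormedSpace.exp ((τ : ℂ) • H)).trace.re := by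
  -- The exponential is the square of a Hermitian matrix.
  have h : NormedSpace.exp ((τ : ℂ) • H) = NormedSpace.exp (((τ / 2 : ℝ) : ℂ) • H) ^ 2 := by
    rw [← Matrix.exp_nsmul]
    congr 1
    rw [← Nat.cast_smul_eq_nsmul ℂ, smul_smul]
    congr 1
    push_cast
    ring
  rw [h]
  exact trace_mul_even_pow_nonneg (isHermitian_exp_smul hH _) hP even_two

theorem hasSum_trace_mul_exp (P H : Matrix m m ℂ) (τ : ℝ) :
    HasSum (fun t : ℕ => (t ! : ℝ)⁻¹ * τ ^ t * (P * H ^ t).trace.re)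
      (P * NormedSpace.exp ((τ : ℂ) • H)).trace.re := by
  let _ : NormedRing (Matrix m m ℂ) := Matrix.linftyOpNormedRing
  let _ : NormedAlgebra ℂ (Matrix m m ℂ) := Matrix.linftyOpNormedAlgebra
  have h := NormedSpace.exp_series_hasSum_exp' (𝕂 := ℂ) ((τ : ℂ) • H)
  let L : Matrix m m ℂ →+ ℝ :=
    { toFun := fun M => (P * M).trace.re
      map_zero' := by simp
      map_add' := fun M N => by simp [mul_add] }
  have hL : Continuous L := by
    change Continuous fun M : Matrix m m ℂ => (P * M).trace.re
    fun_prop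
  refine (h.map L hL).congr_fun ?_
  intro t
  change (t ! : ℝ)⁻¹ * τ ^ t * (P * H ^ t).trace.re
    = (P * (((t ! : ℂ)⁻¹) • ((τ : ℂ) • H) ^ t)).trace.re
  rw [smul_pow, smul_smul, Matrix.mul_smul, Matrix.trace_smul, smul_eq_mul]
  have : (t ! : ℂ)⁻¹ * (τ : ℂ) ^ t = (((t ! : ℝ)⁻¹ * τ ^ t : ℝ) : ℂ) := by push_cast; rfl
  rw [this, Complex.re_ofReal_mul]

/-- The power series of `2 * cosh`, inside a trace. -/
theorem hasSum_trace_mul_cosh (P H : Matrix m m ℂ) (τ : ℝ) :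
    HasSum (fun t : ℕ => 2 * (((2 * t)! : ℝ)⁻¹ * τ ^ (2 * t) * (P * H ^ (2 * t)).trace.re))
      ((P * NormedSpace.exp ((τ : ℂ) • H)).trace.re
        + (P * NormedSpace.exp ((τ : ℂ) • (-H))).trace.re) := by
  have h := (hasSum_trace_mul_exp P H τ).add (hasSum_trace_mul_exp P (-H) τ)
  have hinj : Function.Injective fun t : ℕ => 2 * t := fun a b hab => by
    simpa using hab
  rw [← hinj.hasSum_iff] at h
  · refine h.congr_fun fun t => ?_
    simp only [Function.comp_apply, (even_two_mul t).neg_pow]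
    ring
  · intro r hr
    have hodd : Odd r := by
      rw [← Nat.not_even_iff_odd]
      rintro ⟨a, rfl⟩
      exact hr ⟨a, by simp only; ring⟩
    rw [hodd.neg_pow, mul_neg, Matrix.trace_neg, Complex.neg_re]
    ring

end TraceExp

section Series

open scoped ComplexOrder

variable {ι m : Type*} [Fintype ι]

theorem continuous_series (A : ι → Matrix m m ℂ) : Continuous (series A) := by
  unfold series
  fun_prop

variable [Fintype m] [DecidableEq m]

theorem continuous_trace_mul_exp (P : Matrix m m ℂ) (c : ℂ) :
    Continuous fun H : Matrix m m ℂ => (P * NormedSpace.exp (c • H)).trace := by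
  let _ : NormedRing (Matrix m m ℂ) := Matrix.linftyOpNormedRing
  let _ : NormedAlgebra ℂ (Matrix m m ℂ) := Matrix.linftyOpNormedAlgebra
  let _ : NormedAlgebra ℚ (Matrix m m ℂ) := NormedAlgebra.restrictScalars ℚ ℂ _
  have h : Continuous (NormedSpace.exp : Matrix m m ℂ → Matrix m m ℂ) := NormedSpace.exp_continuous
  have h' : Continuous fun H : Matrix m m ℂ => NormedSpace.exp (c • H) :=
    h.comp (continuous_const_smul c)
  exact (continuous_const.matrix_mul h').matrix_trace

instance isNegInvariant_gaussianReal (v : ℝ≥0) : (gaussianReal 0 v).IsNegInvariant :=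
  ⟨by
    have h := gaussianReal_map_neg (μ := 0) (v := v)
    rw [neg_zero] at h
    exact h⟩

/-- The matrix Gaussian series bound: if `∑ k, A k ^ 2 ≤ w`, then the expected trace exponential of
`∑ k, x k • A k` on the range of a projection `P` commuting with all `A k` is at most that of a
Gaussian variable of variance `v * w`, times the rank of `P`. -/
theorem integral_trace_exp_series_le (v : ℝ≥0) {P : Matrix m m ℂ} {A : ι → Matrix m m ℂ}
    (hP : P.IsHermitian) (hPP : P * P = P) (hA : ∀ k, (A k).IsHermitian)
    (hPA : ∀ k, Commute P (A k)) {w : ℝ} (hw0 : 0 ≤ w)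
    (hw : ((w : ℂ) • (1 : Matrix m m ℂ) - ∑ k, A k * A k).PosSemidef) (τ : ℝ) :
    Integrable (fun x => (P * NormedSpace.exp ((τ : ℂ) • series A x)).trace)
        (Measure.pi fun _ : ι => gaussianReal 0 v) ∧
      ∫ x, (P * NormedSpace.exp ((τ : ℂ) • series A x)).trace.re
          ∂(Measure.pi fun _ : ι => gaussianReal 0 v)
        ≤ P.trace.re * Real.exp (τ ^ 2 * (v * w) / 2) := by
  set γ : Measure (ι → ℝ) := Measure.pi fun _ : ι => gaussianReal 0 v with hγ
  have hPos : P.PosSemidef := by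
    have := Matrix.posSemidef_conjTranspose_mul_self P
    rwa [hP.eq, hPP] at this
  set f : (ι → ℝ) → ℝ := fun x => (P * NormedSpace.exp ((τ : ℂ) • series A x)).trace.re with hf
  have hcont : Continuous fun x => (P * NormedSpace.exp ((τ : ℂ) • series A x)).trace :=
    (continuous_trace_mul_exp P τ).comp (continuous_series A)
  have hfc : Continuous f := Complex.continuous_re.comp hcont
  have hf0 (x : ι → ℝ) : 0 ≤ f x := trace_mul_exp_nonneg hPos (isHermitian_series hA x) τ
  -- The terms of the series of `2 * cosh`, which sum to `f x + f (-x)`.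
  set g : ℕ → (ι → ℝ) → ℝ := fun t x =>
    2 * (((2 * t)! : ℝ)⁻¹ * τ ^ (2 * t) * (P * series A x ^ (2 * t)).trace.re) with hg
  have hneg (x : ι → ℝ) : series A (-x) = -series A x := by
    simp [series, Finset.sum_neg_distrib]
  have hsum (x : ι → ℝ) : HasSum (fun t => g t x) (f x + f (-x)) := by
    simp only [hf, hneg]
    exact hasSum_trace_mul_cosh P (series A x) τ
  have hg0 (t : ℕ) (x : ι → ℝ) : 0 ≤ g t x := by
    have h1 := trace_mul_even_pow_nonneg (isHermitian_series hA x) hPos (even_two_mul t)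
    have h2 : 0 ≤ τ ^ (2 * t) := (even_two_mul t).pow_nonneg τ
    positivity
  have hgi (t : ℕ) : Integrable (g t) γ :=
    ((integrable_trace_mul_series_pow v A P (2 * t)).re.const_mul _).const_mul _
  set y : ℝ := τ ^ 2 * (v * w) / 2 with hy
  have hD : 0 ≤ P.trace.re := (Complex.le_def.1 hPos.trace_nonneg).1
  have hy0 : 0 ≤ y := by positivity
  have hgle (t : ℕ) : ∫ x, g t x ∂γ ≤ 2 * P.trace.re * (y ^ t / t !) := by
    have h := integral_trace_series_pow_le v hP hPP hA hPA hw0 hw t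
    rw [integral_const_mul, integral_const_mul]
    have h2 : 0 ≤ τ ^ (2 * t) := (even_two_mul t).pow_nonneg τ
    calc 2 * (((2 * t)! : ℝ)⁻¹ * τ ^ (2 * t) * ∫ x, (P * series A x ^ (2 * t)).trace.re ∂γ)
        ≤ 2 * (((2 * t)! : ℝ)⁻¹ * τ ^ (2 * t)
            * ((2 * t)! / (2 ^ t * t !) * (v * w) ^ t * P.trace.re)) := by gcongr
      _ = _ := by
          rw [hy, div_pow, mul_pow (τ ^ 2), pow_mul]
          field_simp
  -- The terms are nonnegative, so expectation and series may be exchanged without integrability.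
  have hlint : ∫⁻ x, ENNReal.ofReal (f x + f (-x)) ∂γ
      ≤ ENNReal.ofReal (2 * P.trace.re * Real.exp y) := by
    have hs : HasSum (fun t : ℕ => 2 * P.trace.re * (y ^ t / t !))
        (2 * P.trace.re * Real.exp y) := by
      rw [Real.exp_eq_exp_ℝ]
      exact (NormedSpace.expSeries_div_hasSum_exp y).mul_left _
    calc ∫⁻ x, ENNReal.ofReal (f x + f (-x)) ∂γ
        = ∫⁻ x, ∑' t, ENNReal.ofReal (g t x) ∂γ := by
          refine lintegral_congr fun x => ?_
          rw [← (hsum x).tsum_eq,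
            ENNReal.ofReal_tsum_of_nonneg (fun t => hg0 t x) (hsum x).summable]
      _ = ∑' t, ∫⁻ x, ENNReal.ofReal (g t x) ∂γ :=
          lintegral_tsum fun t => (hgi t).aestronglyMeasurable.aemeasurable.ennreal_ofReal
      _ = ∑' t, ENNReal.ofReal (∫ x, g t x ∂γ) := by
          congr 1
          ext t
          rw [ofReal_integral_eq_lintegral_ofReal (hgi t) (ae_of_all _ (hg0 t))]
      _ ≤ ∑' t, ENNReal.ofReal (2 * P.trace.re * (y ^ t / t !)) :=
          ENNReal.tsum_le_tsum fun t => ENNReal.ofReal_le_ofReal (hgle t)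
      _ = ENNReal.ofReal (2 * P.trace.re * Real.exp y) := by
          rw [← hs.tsum_eq, ENNReal.ofReal_tsum_of_nonneg (fun t => by positivity) hs.summable]
  have hcc : Continuous fun x => f x + f (-x) := hfc.add (hfc.comp continuous_neg)
  have hc0 (x : ι → ℝ) : 0 ≤ f x + f (-x) := add_nonneg (hf0 x) (hf0 (-x))
  have hci : Integrable (fun x => f x + f (-x)) γ := by
    refine ⟨hcc.aestronglyMeasurable, ?_⟩
    rw [hasFiniteIntegral_iff_ofReal (ae_of_all _ hc0)]
    exact hlint.trans_lt ENNReal.ofReal_lt_top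
  have hfi : Integrable f γ := by
    refine hci.mono' hfc.aestronglyMeasurable (ae_of_all _ fun x => ?_)
    rw [Real.norm_of_nonneg (hf0 x)]
    linarith [hf0 (-x)]
  refine ⟨?_, ?_⟩
  · refine hfi.mono' hcont.aestronglyMeasurable (ae_of_all _ fun x => le_of_eq ?_)
    have him := trace_mul_exp_im hP (isHermitian_series hA x) τ
    rw [Complex.norm_def, Complex.normSq_apply, him, mul_zero, add_zero,
      Real.sqrt_mul_self (hf0 x)]
  · have h1 : ∫ x, (f x + f (-x)) ∂γ ≤ 2 * P.trace.re * Real.exp y := by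
      rw [integral_eq_lintegral_of_nonneg_ae (ae_of_all _ hc0) hcc.aestronglyMeasurable]
      exact ENNReal.toReal_le_of_le_ofReal (by positivity) hlint
    -- By symmetry of the Gaussian measure, `f (-x)` has the same integral as `f x`.
    rw [integral_add hfi hfi.comp_neg, integral_neg_eq_self f γ] at h1
    linarith

end Series

/-! ### The projection onto the symmetric subspace -/

section Symmetrizer

/-- The orthogonal projection onto the symmetric subspace: the average of the permutation operators
of the qudits. -/
noncomputable def symmetrizer (N n : ℕ) : Operator N n :=
  Matrix.of fun α β => (n ! : ℂ)⁻¹ * ∑ σ : Equiv.Perm (Fin n), if α ∘ σ = β then 1 else 0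

variable {N n : ℕ}

theorem comp_perm_eq_iff (σ : Equiv.Perm (Fin n)) (α β : Fin n → Fin N) :
    α ∘ σ = β ↔ β ∘ (σ⁻¹ : Equiv.Perm (Fin n)) = α := by
  constructor
  · rintro rfl
    ext j
    simp
  · rintro rfl
    ext j
    simp

theorem symmetrizer_mul_apply (X : Operator N n) (α β : Fin n → Fin N) :
    (symmetrizer N n * X) α β
      = (n ! : ℂ)⁻¹ * ∑ σ : Equiv.Perm (Fin n), X (α ∘ σ) β := by
  simp only [symmetrizer, Matrix.mul_apply, Matrix.of_apply, mul_assoc, ← Finset.mul_sum,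
    Finset.sum_mul]
  rw [Finset.sum_comm]
  simp

theorem mul_symmetrizer_apply (X : Operator N n) (α β : Fin n → Fin N) :
    (X * symmetrizer N n) α β
      = (n ! : ℂ)⁻¹ * ∑ σ : Equiv.Perm (Fin n), X α (β ∘ σ) := by
  have h (σ : Equiv.Perm (Fin n)) :
      ∑ γ : Fin n → Fin N, X α γ * (if γ ∘ σ = β then 1 else 0)
        = X α (β ∘ (σ⁻¹ : Equiv.Perm (Fin n))) := by
    simp only [if_congr (comp_perm_eq_iff σ _ β) rfl rfl]
    simp
  rw [← Equiv.sum_comp (Equiv.inv (Equiv.Perm (Fin n)))]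
  simp only [Equiv.inv_apply, ← h, Finset.mul_sum, Matrix.mul_apply, symmetrizer, Matrix.of_apply]
  rw [Finset.sum_comm]
  refine Finset.sum_congr rfl fun σ _ => Finset.sum_congr rfl fun γ _ => ?_
  ring

theorem symmetrizer_mulVec_apply (ψ : (Fin n → Fin N) → ℂ) (α : Fin n → Fin N) :
    (symmetrizer N n *ᵥ ψ) α = (n ! : ℂ)⁻¹ * ∑ σ : Equiv.Perm (Fin n), ψ (α ∘ σ) := by
  simp only [symmetrizer, Matrix.mulVec, dotProduct, Matrix.of_apply, mul_assoc,
    ← Finset.mul_sum, Finset.sum_mul]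
  rw [Finset.sum_comm]
  simp

theorem symmetrizer_isHermitian : (symmetrizer N n).IsHermitian := by
  ext1 α β
  simp only [symmetrizer, Matrix.conjTranspose_apply, Matrix.of_apply, star_mul', star_inv₀,
    star_natCast, star_sum, apply_ite (star : ℂ → ℂ), star_one, star_zero]
  congr 1
  rw [← Equiv.sum_comp (Equiv.inv (Equiv.Perm (Fin n)))]
  exact Finset.sum_congr rfl fun σ _ =>
    (if_congr (comp_perm_eq_iff σ α β) rfl rfl).symm

theorem symmetrizer_mulVec_of_mem {ψ : (Fin n → Fin N) → ℂ} (hψ : ψ ∈ symSubspace N n) :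
    symmetrizer N n *ᵥ ψ = ψ := by
  ext α
  have hψ' : ∀ σ : Equiv.Perm (Fin n), ψ (α ∘ σ) = ψ α := fun σ => hψ σ α
  rw [symmetrizer_mulVec_apply]
  simp only [hψ', Finset.sum_const, Finset.card_univ, Fintype.card_perm, Fintype.card_fin,
    nsmul_eq_mul]
  rw [inv_mul_cancel_left₀ (Nat.cast_ne_zero.2 (Nat.factorial_ne_zero n))]

theorem symmetrizer_mulVec_mem (ψ : (Fin n → Fin N) → ℂ) :
    symmetrizer N n *ᵥ ψ ∈ symSubspace N n := by
  intro σ α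
  rw [symmetrizer_mulVec_apply, symmetrizer_mulVec_apply]
  congr 1
  exact Fintype.sum_equiv (Equiv.mulLeft σ) _ _ fun ρ => rfl

theorem symmetrizer_mul_self : symmetrizer N n * symmetrizer N n = symmetrizer N n := by
  refine Matrix.toLin'.injective (LinearMap.ext fun ψ => ?_)
  rw [Matrix.toLin'_mul_apply, Matrix.toLin'_apply, Matrix.toLin'_apply]
  exact symmetrizer_mulVec_of_mem (symmetrizer_mulVec_mem ψ)

theorem commute_symmetrizer {X : Operator N n}
    (hX : ∀ (σ : Equiv.Perm (Fin n)) (α β : Fin n → Fin N), X (α ∘ σ) (β ∘ σ) = X α β) :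
    Commute (symmetrizer N n) X := by
  ext1 α β
  rw [symmetrizer_mul_apply, mul_symmetrizer_apply]
  congr 1
  rw [← Equiv.sum_comp (Equiv.inv (Equiv.Perm (Fin n)))]
  refine Finset.sum_congr rfl fun σ _ => ?_
  rw [← hX (Equiv.inv _ σ) α (β ∘ σ)]
  congr 1
  ext j
  simp

/-- The trace over the symmetric subspace is the trace on the full space against the symmetrizer. -/
theorem trace_restrict_symSubspace (X : Operator N n)
    (hX : ∀ ψ ∈ symSubspace N n, Matrix.toLin' X ψ ∈ symSubspace N n) :
    LinearMap.trace ℂ (symSubspace N n) ((Matrix.toLin' X).restrict hX)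
      = (symmetrizer N n * X).trace := by
  let π : ((Fin n → Fin N) → ℂ) →ₗ[ℂ] symSubspace N n :=
    (Matrix.toLin' (symmetrizer N n)).codRestrict _ fun ψ => symmetrizer_mulVec_mem ψ
  have h1 : (Matrix.toLin' X).restrict hX
      = π ∘ₗ (Matrix.toLin' X ∘ₗ (symSubspace N n).subtype) := by
    ext1 ψ
    apply Subtype.ext
    exact (symmetrizer_mulVec_of_mem (hX ψ ψ.2)).symm
  have h2 : (Matrix.toLin' X ∘ₗ (symSubspace N n).subtype) ∘ₗ π
      = Matrix.toLin' (X * symmetrizer N n) := by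
    rw [Matrix.toLin'_mul]
    rfl
  rw [h1, LinearMap.trace_comp_comm', h2, Matrix.trace_toLin'_eq, Matrix.trace_mul_comm]

theorem trace_symmetrizer : (symmetrizer N n).trace = symDim N n := by
  have h := trace_restrict_symSubspace (1 : Operator N n) (fun ψ hψ => by simpa using hψ)
  rw [Matrix.mul_one] at h
  rw [← h, symDim, ← LinearMap.trace_id]
  congr 1
  ext1 ψ
  apply Subtype.ext
  simp

theorem trExp_eq_trace {p : ℕ} (τ : ℝ) (T : Tensor p N) :
    trExp n τ T = (symmetrizer N n * NormedSpace.exp ((τ : ℂ) • hamiltonian n T)).trace :=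
  trace_restrict_symSubspace _ _

end Symmetrizer

/-! ### The Schur test and row sums of products of ketbras -/

section SchurTest

open scoped ComplexOrder

/-- The Schur test for Hermitian matrices, by Gershgorin's theorem: all eigenvalues are at most the
largest absolute row sum. -/
theorem posSemidef_smul_one_sub_of_row_sum_le {m : Type*} [Fintype m] [DecidableEq m]
    {M : Matrix m m ℂ} (hM : M.IsHermitian) {w : ℝ} (hw : ∀ i, ∑ j, ‖M i j‖ ≤ w) :
    ((w : ℂ) • (1 : Matrix m m ℂ) - M).PosSemidef := by
  have hA : ((w : ℂ) • (1 : Matrix m m ℂ) - M).IsHermitian := by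
    rw [Matrix.IsHermitian, Matrix.conjTranspose_sub, Matrix.conjTranspose_smul, hM.eq,
      Matrix.conjTranspose_one, Complex.star_def, Complex.conj_ofReal]
  rw [hA.posSemidef_iff_eigenvalues_nonneg]
  intro l
  have hev : Module.End.HasEigenvalue (Matrix.toLin' ((w : ℂ) • (1 : Matrix m m ℂ) - M))
      (hA.eigenvalues l : ℂ) := by
    refine Module.End.hasEigenvalue_of_hasEigenvector (x := ⇑(hA.eigenvectorBasis l)) ⟨?_, ?_⟩
    · rw [Module.End.mem_eigenspace_iff, Matrix.toLin'_apply, hA.mulVec_eigenvectorBasis]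
      exact (Complex.coe_smul _ _).symm
    · intro h
      exact hA.eigenvectorBasis.toBasis.ne_zero l (by
        rw [OrthonormalBasis.coe_toBasis]
        ext j
        exact congrFun h j)
  obtain ⟨k, hk⟩ := eigenvalue_mem_ball hev
  rw [mem_closedBall_iff_norm] at hk
  have e (j : m) (hj : j ∈ Finset.univ.erase k) :
      ‖((w : ℂ) • (1 : Matrix m m ℂ) - M) k j‖ = ‖M k j‖ := by
    rw [Matrix.sub_apply, Matrix.smul_apply, Matrix.one_apply_ne (Finset.ne_of_mem_erase hj).symm]
    simp
  rw [Finset.sum_congr rfl e, Matrix.sub_apply, Matrix.smul_apply, Matrix.one_apply_eq,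
    smul_eq_mul, mul_one] at hk
  have h1 := (Complex.abs_re_le_norm _).trans hk
  have h2 := hw k
  rw [← Finset.add_sum_erase _ _ (Finset.mem_univ k)] at h2
  have h3 := Complex.re_le_norm (M k k)
  have h4 := (abs_le.1 h1).1
  simp only [Complex.sub_re, Complex.ofReal_re] at h4
  change (0 : ℝ) ≤ hA.eigenvalues l
  linarith

end SchurTest

section KetBra

variable {N n k : ℕ}

theorem conjTranspose_ketBra (i : Fin k ↪ Fin n) (a b : Fin k → Fin N) :
    (ketBra i a b)ᴴ = ketBra i b a := by
  ext1 α β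
  simp only [ketBra, Matrix.conjTranspose_apply, Matrix.of_apply, apply_ite (star : ℂ → ℂ),
    star_one, star_zero]
  refine if_congr ?_ rfl rfl
  refine and_congr (forall_congr' fun c => and_comm) ?_
  exact forall_congr' fun j => imp_congr_right fun _ => eq_comm

/-- A row of `ketBra j b a` has at most one nonzero entry. -/
theorem sum_norm_ketBra_le (j : Fin k ↪ Fin n) (b a : Fin k → Fin N) (γ : Fin n → Fin N) :
    ∑ β, ‖ketBra j b a γ β‖ ≤ if γ ∘ j = b then 1 else 0 := by
  classical
  by_cases h : γ ∘ j = b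
  · rw [if_pos h]
    -- The only possible `β` is `a` along `j` and agrees with `γ` off the range of `j`.
    have hle : ∀ β, ‖ketBra j b a γ β‖ ≤
        if β = (fun l => if hl : l ∈ Set.range j then a (Classical.choose hl) else γ l)
        then 1 else 0 := by
      intro β
      simp only [ketBra, Matrix.of_apply]
      split_ifs with h1 h2 h2
      · simp
      · refine absurd (funext fun l => ?_) h2
        split_ifs with hl
        · conv_lhs => rw [← Classical.choose_spec hl]
          exact (h1.1 _).2
        · exact (h1.2 l hl).symm
      · simp
      · simp
    refine (Finset.sum_le_sum fun β _ => hle β).trans ?_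
    simp
  · rw [if_neg h]
    refine le_of_eq (Finset.sum_eq_zero fun β _ => ?_)
    rw [norm_eq_zero]
    simp only [ketBra, Matrix.of_apply]
    rw [if_neg]
    exact fun h1 => h (funext fun c => (h1.1 c).1)

/-- The configurations that agree with `α` off the range of `i` and have the same values along `i`
and along `j`. They are determined by their values along `i`; if `i c ≠ j c` for some `c`, then the
value at `i c` is redundant. -/
theorem card_agree_le (i j : Fin k ↪ Fin n) (α : Fin n → Fin N) (s : Finset (Fin n → Fin N))
    (hs : ∀ γ ∈ s, (∀ l, l ∉ Set.range i → α l = γ l) ∧ γ ∘ j = γ ∘ i) :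
    s.card ≤ if i = j then N ^ k else N ^ (k - 1) := by
  classical
  split_ifs with hij
  · have h : s.card ≤ (Finset.univ : Finset (Fin k → Fin N)).card := by
      refine Finset.card_le_card_of_injOn (fun γ => γ ∘ i) (fun _ _ => Finset.mem_univ _) ?_
      intro γ hγ γ' hγ' h
      ext1 l
      by_cases hl : l ∈ Set.range i
      · obtain ⟨c, rfl⟩ := hl
        exact congrFun h c
      · rw [← (hs γ hγ).1 l hl, ← (hs γ' hγ').1 l hl]
    simpa using h
  · obtain ⟨c, hc⟩ : ∃ c, i c ≠ j c := by
      by_contra! h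
      exact hij (DFunLike.ext _ _ h)
    have h : s.card ≤ (Finset.univ : Finset ({d : Fin k // d ≠ c} → Fin N)).card := by
      refine Finset.card_le_card_of_injOn (fun γ d => γ (i d)) (fun _ _ => Finset.mem_univ _) ?_
      intro γ hγ γ' hγ' h
      have h1 : ∀ l, l ≠ i c → γ l = γ' l := by
        intro l hlc
        by_cases hl : l ∈ Set.range i
        · obtain ⟨d, rfl⟩ := hl
          exact congrFun h ⟨d, fun hd => hlc (congrArg i hd)⟩
        · rw [← (hs γ hγ).1 l hl, ← (hs γ' hγ').1 l hl]
      ext1 l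
      by_cases hl : l = i c
      · subst hl
        have e1 : γ (j c) = γ (i c) := congrFun (hs γ hγ).2 c
        have e2 : γ' (j c) = γ' (i c) := congrFun (hs γ' hγ').2 c
        rw [← e1, ← e2]
        exact h1 _ hc.symm
      · exact h1 l hl
    simpa [Fintype.card_subtype_compl] using h

/-- The row sums of `∑ ketBra i a b * ketBra j b a`, over all `a` and `b`. -/
theorem sum_row_norm_le (i j : Fin k ↪ Fin n) (α : Fin n → Fin N) :
    ∑ a : Fin k → Fin N, ∑ b : Fin k → Fin N, ∑ β, ‖(ketBra i a b * ketBra j b a) α β‖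
      ≤ if i = j then (N : ℝ) ^ k else (N : ℝ) ^ (k - 1) := by
  classical
  have h1 (a b : Fin k → Fin N) : ∑ β, ‖(ketBra i a b * ketBra j b a) α β‖
      ≤ ∑ γ, ‖ketBra i a b α γ‖ * if γ ∘ j = b then 1 else 0 := by
    calc ∑ β, ‖(ketBra i a b * ketBra j b a) α β‖
        ≤ ∑ β, ∑ γ, ‖ketBra i a b α γ‖ * ‖ketBra j b a γ β‖ := by
          refine Finset.sum_le_sum fun β _ => ?_
          rw [Matrix.mul_apply]
          exact (norm_sum_le _ _).trans_eq (Finset.sum_congr rfl fun γ _ => norm_mul _ _)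
      _ = ∑ γ, ‖ketBra i a b α γ‖ * ∑ β, ‖ketBra j b a γ β‖ := by
          rw [Finset.sum_comm]
          simp only [Finset.mul_sum]
      _ ≤ _ := Finset.sum_le_sum fun γ _ =>
          mul_le_mul_of_nonneg_left (sum_norm_ketBra_le j b a γ) (norm_nonneg _)
  set s : Finset (Fin n → Fin N) :=
    {γ | (∀ l, l ∉ Set.range i → α l = γ l) ∧ γ ∘ j = γ ∘ i} with hs
  have h2 (γ : Fin n → Fin N) :
      ∑ a : Fin k → Fin N, ∑ b : Fin k → Fin N, ‖ketBra i a b α γ‖ * (if γ ∘ j = b then 1 else 0)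
        ≤ if γ ∈ s then (1 : ℝ) else 0 := by
    simp only [mul_ite, mul_one, mul_zero, Finset.sum_ite_eq, Finset.mem_univ, if_true]
    have h3 (a : Fin k → Fin N) : ‖ketBra i a (γ ∘ j) α γ‖
        ≤ if a = α ∘ i then (if γ ∈ s then 1 else 0) else 0 := by
      by_cases h : (∀ c, α (i c) = a c ∧ γ (i c) = (γ ∘ j) c) ∧ ∀ l, l ∉ Set.range i → α l = γ l
      · have ha : a = α ∘ i := funext fun c => (h.1 c).1.symm
        have hγ : γ ∈ s := by
          rw [hs, Finset.mem_filter]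
          exact ⟨Finset.mem_univ _, h.2, funext fun c => ((h.1 c).2).symm⟩
        rw [if_pos ha, if_pos hγ]
        simp only [ketBra, Matrix.of_apply]
        rw [if_pos h, norm_one]
      · simp only [ketBra, Matrix.of_apply]
        rw [if_neg h, norm_zero]
        split_ifs <;> norm_num
    refine (Finset.sum_le_sum fun a _ => h3 a).trans ?_
    simp
  have h4 := card_agree_le i j α s (fun γ hγ => (Finset.mem_filter.1 hγ).2)
  calc ∑ a : Fin k → Fin N, ∑ b : Fin k → Fin N, ∑ β, ‖(ketBra i a b * ketBra j b a) α β‖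
      ≤ ∑ a : Fin k → Fin N, ∑ b : Fin k → Fin N,
          ∑ γ, ‖ketBra i a b α γ‖ * if γ ∘ j = b then 1 else 0 :=
        Finset.sum_le_sum fun a _ => Finset.sum_le_sum fun b _ => h1 a b
    _ = ∑ γ, ∑ a : Fin k → Fin N, ∑ b : Fin k → Fin N,
          ‖ketBra i a b α γ‖ * if γ ∘ j = b then 1 else 0 := by
        exact Finset.sum_comm_cycle
    _ ≤ ∑ γ, if γ ∈ s then (1 : ℝ) else 0 := Finset.sum_le_sum fun γ _ => h2 γ
    _ = (s.card : ℝ) := by simp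
    _ ≤ ((if i = j then N ^ k else N ^ (k - 1) : ℕ) : ℝ) := by exact_mod_cast h4
    _ = _ := by push_cast; rfl

end KetBra

/-! ### The bound on the collective operators, and two inequalities for squares -/

section VarianceBound

open scoped ComplexOrder MatrixOrder

variable {N n k : ℕ}

/-- The operator `∑ i, |a⟩_i ⟨b|`, summed over all ordered choices `i` of `k` distinct qudits. -/
noncomputable def collective (n : ℕ) (a b : Fin k → Fin N) : Operator N n :=
  ∑ i : Fin k ↪ Fin n, ketBra i a b

theorem conjTranspose_collective (a b : Fin k → Fin N) :
    (collective n a b)ᴴ = collective n b a := by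
  simp only [collective, Matrix.conjTranspose_sum, conjTranspose_ketBra]

/-- An upper bound for `∑ (collective a b) * (collective a b)ᴴ`: the first term comes from equal
choices of qudits, the second one from pairs of different choices. -/
noncomputable def varianceBound (N n k : ℕ) : ℝ :=
  (n.descFactorial k : ℝ) * (N : ℝ) ^ k + (n.descFactorial k : ℝ) ^ 2 * (N : ℝ) ^ (k - 1)

theorem varianceBound_nonneg (N n k : ℕ) : 0 ≤ varianceBound N n k := by
  unfold varianceBound
  positivity

theorem sum_collective_le (N n k : ℕ) :
    ∑ a : Fin k → Fin N, ∑ b : Fin k → Fin N, collective n a b * collective n b a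
      ≤ (varianceBound N n k : ℂ) • (1 : Operator N n) := by
  classical
  rw [Matrix.le_iff]
  refine posSemidef_smul_one_sub_of_row_sum_le ?_ fun α => ?_
  · rw [Matrix.IsHermitian, Matrix.conjTranspose_sum]
    refine Finset.sum_congr rfl fun a _ => ?_
    rw [Matrix.conjTranspose_sum]
    refine Finset.sum_congr rfl fun b _ => ?_
    rw [Matrix.conjTranspose_mul, conjTranspose_collective, conjTranspose_collective]
  · have h1 : ∀ β, ‖(∑ a : Fin k → Fin N, ∑ b : Fin k → Fin N,
          collective n a b * collective n b a) α β‖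
        ≤ ∑ i : Fin k ↪ Fin n, ∑ j : Fin k ↪ Fin n, ∑ a : Fin k → Fin N, ∑ b : Fin k → Fin N,
          ‖(ketBra i a b * ketBra j b a) α β‖ := by
      intro β
      have e : ∑ a : Fin k → Fin N, ∑ b : Fin k → Fin N, collective n a b * collective n b a
          = ∑ i : Fin k ↪ Fin n, ∑ j : Fin k ↪ Fin n, ∑ a : Fin k → Fin N, ∑ b : Fin k → Fin N,
            ketBra i a b * ketBra j b a := by
        simp only [collective, Finset.sum_mul_sum]
        rw [Finset.sum_comm_cycle]
        refine Finset.sum_congr rfl fun i _ => ?_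
        exact Finset.sum_comm_cycle
      rw [e]
      simp only [Matrix.sum_apply]
      refine (norm_sum_le _ _).trans (Finset.sum_le_sum fun i _ => ?_)
      refine (norm_sum_le _ _).trans (Finset.sum_le_sum fun j _ => ?_)
      refine (norm_sum_le _ _).trans (Finset.sum_le_sum fun a _ => ?_)
      exact norm_sum_le _ _
    have h2 (i j : Fin k ↪ Fin n) : ∑ β, ∑ a : Fin k → Fin N, ∑ b : Fin k → Fin N,
          ‖(ketBra i a b * ketBra j b a) α β‖
        ≤ (if i = j then (N : ℝ) ^ k else 0) + (N : ℝ) ^ (k - 1) := by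
      rw [← Finset.sum_comm_cycle]
      refine (sum_row_norm_le i j α).trans ?_
      have : (0 : ℝ) ≤ (N : ℝ) ^ (k - 1) := by positivity
      split_ifs <;> linarith
    calc _ ≤ ∑ β, ∑ i : Fin k ↪ Fin n, ∑ j : Fin k ↪ Fin n, ∑ a : Fin k → Fin N,
            ∑ b : Fin k → Fin N, ‖(ketBra i a b * ketBra j b a) α β‖ :=
          Finset.sum_le_sum fun β _ => h1 β
      _ = ∑ i : Fin k ↪ Fin n, ∑ j : Fin k ↪ Fin n, ∑ β, ∑ a : Fin k → Fin N,
            ∑ b : Fin k → Fin N, ‖(ketBra i a b * ketBra j b a) α β‖ :=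
          Finset.sum_comm_cycle.symm
      _ ≤ ∑ i : Fin k ↪ Fin n, ∑ j : Fin k ↪ Fin n,
            ((if i = j then (N : ℝ) ^ k else 0) + (N : ℝ) ^ (k - 1)) :=
          Finset.sum_le_sum fun i _ => Finset.sum_le_sum fun j _ => h2 i j
      _ = varianceBound N n k := by
          simp only [Finset.sum_add_distrib, Finset.sum_ite_eq, Finset.mem_univ, if_true,
            Finset.sum_const, Finset.card_univ, Fintype.card_embedding_eq, Fintype.card_fin,
            nsmul_eq_mul, varianceBound]
          ring

variable {m : Type*} [Fintype m]

/-- The square of `(c • K + (c • K)ᴴ) / 2`, for `c` of modulus one, is at most the mean of `K * Kᴴ`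
and `Kᴴ * K`; the difference is the square of `(c • K - (c • K)ᴴ) / 2`. -/
theorem sq_half_add_conjTranspose_le (K : Matrix m m ℂ) {c : ℂ} (hc : c * star c = 1) :
    ((1 / 2 : ℂ) • (c • K + (c • K)ᴴ)) * ((1 / 2 : ℂ) • (c • K + (c • K)ᴴ))
      ≤ (1 / 2 : ℂ) • (K * Kᴴ + Kᴴ * K) := by
  rw [Matrix.le_iff]
  have h := Matrix.posSemidef_conjTranspose_mul_self ((1 / 2 : ℂ) • (c • K - (c • K)ᴴ))
  have e1 : (c • K) * (c • K)ᴴ = K * Kᴴ := by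
    rw [Matrix.conjTranspose_smul, Matrix.smul_mul, Matrix.mul_smul, smul_smul, hc, one_smul]
  have e2 : (c • K)ᴴ * (c • K) = Kᴴ * K := by
    rw [Matrix.conjTranspose_smul, Matrix.smul_mul, Matrix.mul_smul, smul_smul, mul_comm, hc,
      one_smul]
  have e3 : star (1 / 2 : ℂ) = 1 / 2 := by simp
  have key : (1 / 2 : ℂ) • (K * Kᴴ + Kᴴ * K)
        - ((1 / 2 : ℂ) • (c • K + (c • K)ᴴ)) * ((1 / 2 : ℂ) • (c • K + (c • K)ᴴ))
      = ((1 / 2 : ℂ) • (c • K - (c • K)ᴴ))ᴴ * ((1 / 2 : ℂ) • (c • K - (c • K)ᴴ)) := by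
    rw [← e1, ← e2]
    generalize c • K = L
    rw [Matrix.conjTranspose_smul, e3, Matrix.conjTranspose_sub,
      Matrix.conjTranspose_conjTranspose]
    simp only [Matrix.smul_mul, Matrix.mul_smul, add_mul, mul_add, sub_mul, mul_sub]
    module
  rw [key]
  exact h

/-- Convexity of the square on Hermitian matrices: the square of an average is at most the average
of the squares, and the difference is the average of the squared deviations. -/
theorem sq_average_le {ρ : Type*} [Fintype ρ] [Nonempty ρ] {B : ρ → Matrix m m ℂ}
    (hB : ∀ r, (B r).IsHermitian) :
    ((Fintype.card ρ : ℂ)⁻¹ • ∑ r, B r) * ((Fintype.card ρ : ℂ)⁻¹ • ∑ r, B r)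
      ≤ (Fintype.card ρ : ℂ)⁻¹ • ∑ r, B r * B r := by
  set c : ℂ := (Fintype.card ρ : ℂ) with hc
  have hc0 : c ≠ 0 := Nat.cast_ne_zero.2 Fintype.card_ne_zero
  set M : Matrix m m ℂ := c⁻¹ • ∑ r, B r with hM
  have hMH : Mᴴ = M := by
    rw [hM, Matrix.conjTranspose_smul, Matrix.conjTranspose_sum, star_inv₀, hc, star_natCast]
    congr 1
    exact Finset.sum_congr rfl fun r _ => (hB r).eq
  have hMs : ∑ r, B r = c • M := by rw [hM, smul_inv_smul₀ hc0]
  have h1 : ∑ r, (B r - M)ᴴ * (B r - M) = ∑ r, B r * B r - c • (M * M) := by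
    have e (r : ρ) : (B r - M)ᴴ * (B r - M) = B r * B r - B r * M - (M * B r - M * M) := by
      rw [Matrix.conjTranspose_sub, hMH, (hB r).eq, sub_mul, mul_sub, mul_sub]
    simp only [e, Finset.sum_sub_distrib, ← Finset.sum_mul, ← Finset.mul_sum, hMs,
      Finset.sum_const, Finset.card_univ, Matrix.smul_mul, Matrix.mul_smul,
      ← Nat.cast_smul_eq_nsmul ℂ, ← hc]
    module
  have h2 : 0 ≤ ∑ r, (B r - M)ᴴ * (B r - M) :=
    Finset.sum_nonneg fun r _ =>
      Matrix.nonneg_iff_posSemidef.2 (Matrix.posSemidef_conjTranspose_mul_self _)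
  rw [Matrix.le_iff]
  have h3 := (Matrix.nonneg_iff_posSemidef.1 h2).smul
    (show (0 : ℂ) ≤ c⁻¹ from inv_nonneg.2 (by rw [hc]; exact Nat.cast_nonneg _))
  rwa [h1, smul_sub, inv_smul_smul₀ hc0] at h3

end VarianceBound

/-! ### The Hamiltonian of a Gaussian tensor -/

section Hamiltonian

open scoped ComplexOrder MatrixOrder

variable {p N : ℕ}

theorem sum_interaction (n : ℕ) (T : Tensor p N) :
    ∑ i : Fin (p / 2) ↪ Fin n, interaction T i
      = ∑ μ : Fin p → Fin N, T μ • collective n (firstHalf μ) (lastHalf μ) := by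
  simp only [interaction, collective, Finset.smul_sum]
  exact Finset.sum_comm

theorem hamiltonian_eq (n : ℕ) (T : Tensor p N) :
    hamiltonian n T
      = (1 / 2 : ℂ) • (∑ μ : Fin p → Fin N, T μ • collective n (firstHalf μ) (lastHalf μ)
        + (∑ μ : Fin p → Fin N, T μ • collective n (firstHalf μ) (lastHalf μ))ᴴ) := by
  rw [hamiltonian, Finset.sum_add_distrib, ← Matrix.conjTranspose_sum, sum_interaction]

/-- The Hamiltonian as a real-linear function of the tensor. -/
noncomputable def hamiltonianLinear (p N n : ℕ) : Tensor p N →ₗ[ℝ] Operator N n where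
  toFun := hamiltonian n
  map_add' S T := by
    simp only [hamiltonian_eq, Pi.add_apply, add_smul, Finset.sum_add_distrib,
      Matrix.conjTranspose_add]
    module
  map_smul' r T := by
    have h : ∑ μ : Fin p → Fin N, (r • T) μ • collective n (firstHalf μ) (lastHalf μ)
        = (r : ℂ) • ∑ μ : Fin p → Fin N, T μ • collective n (firstHalf μ) (lastHalf μ) := by
      simp only [Pi.smul_apply, Finset.smul_sum, smul_smul, Complex.real_smul]
    rw [hamiltonian_eq, hamiltonian_eq, h, Matrix.conjTranspose_smul, Complex.star_def,
      Complex.conj_ofReal, ← smul_add, smul_comm, RingHom.id_apply, Complex.coe_smul]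

theorem hamiltonianLinear_apply (n : ℕ) (T : Tensor p N) :
    hamiltonianLinear p N n T = hamiltonian n T := rfl

theorem hamiltonian_sum_smul {ι : Type*} [Fintype ι] (n : ℕ) (t : ι → Tensor p N) (x : ι → ℝ) :
    hamiltonian n (∑ k, (x k : ℂ) • t k) = series (fun k => hamiltonian n (t k)) x := by
  rw [← hamiltonianLinear_apply, map_sum, series]
  refine Finset.sum_congr rfl fun k _ => ?_
  rw [Complex.coe_smul, map_smul, Complex.coe_smul, hamiltonianLinear_apply]

theorem continuous_hamiltonian (n : ℕ) :
    Continuous (hamiltonian n : Tensor p N → Operator N n) :=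
  (hamiltonianLinear p N n).continuous_of_finiteDimensional

theorem hamiltonian_single (n : ℕ) (μ : Fin p → Fin N) (c : ℂ) :
    hamiltonian n (Pi.single μ c : Tensor p N)
      = (1 / 2 : ℂ) • (c • collective n (firstHalf μ) (lastHalf μ)
        + (c • collective n (firstHalf μ) (lastHalf μ))ᴴ) := by
  have h : ∑ ν : Fin p → Fin N, (Pi.single μ c : Tensor p N) ν
        • collective n (firstHalf ν) (lastHalf ν)
      = c • collective n (firstHalf μ) (lastHalf μ) := by
    rw [Finset.sum_eq_single μ (fun ν _ hν => by rw [Pi.single_eq_of_ne hν, zero_smul])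
      (fun h => absurd (Finset.mem_univ _) h), Pi.single_eq_same]
  rw [hamiltonian_eq, h]

/-- For even `p`, a multi-index is the same as a pair of half multi-indices. -/
theorem bijective_halves (hp : Even p) :
    Function.Bijective fun μ : Fin p → Fin N => (firstHalf μ, lastHalf μ) := by
  obtain ⟨k, rfl⟩ := hp
  constructor
  · intro μ ν h
    rw [Prod.mk.injEq] at h
    ext1 l
    by_cases hl : (l : ℕ) < (k + k) / 2
    · exact congrFun h.1 ⟨l, hl⟩
    · have e : (⟨(l : ℕ) - (k + k) / 2 + (k + k) / 2, by omega⟩ : Fin (k + k)) = l :=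
        Fin.ext (Nat.sub_add_cancel (not_lt.1 hl))
      have := congrFun h.2 ⟨(l : ℕ) - (k + k) / 2, by omega⟩
      simp only [lastHalf, e] at this
      exact this
  · rintro ⟨a, b⟩
    refine ⟨fun l => if hl : (l : ℕ) < (k + k) / 2 then a ⟨l, hl⟩
      else b ⟨(l : ℕ) - (k + k) / 2, by omega⟩, ?_⟩
    rw [Prod.mk.injEq]
    constructor
    · ext1 c
      simp [firstHalf]
    · ext1 c
      simp [lastHalf]

theorem sum_sq_hamiltonian_single_le (hp : Even p) (n : ℕ) {c : ℂ} (hc : c * star c = 1) :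
    ∑ μ : Fin p → Fin N, hamiltonian n (Pi.single μ c : Tensor p N)
        * hamiltonian n (Pi.single μ c : Tensor p N)
      ≤ (varianceBound N n (p / 2) : ℂ) • (1 : Operator N n) := by
  set W : Operator N n := ∑ a : Fin (p / 2) → Fin N, ∑ b : Fin (p / 2) → Fin N,
    collective n a b * collective n b a with hW
  have h1 : ∑ μ : Fin p → Fin N, (1 / 2 : ℂ) • (collective n (firstHalf μ) (lastHalf μ)
          * (collective n (firstHalf μ) (lastHalf μ))ᴴ
        + (collective n (firstHalf μ) (lastHalf μ))ᴴ * collective n (firstHalf μ) (lastHalf μ))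
      = W := by
    rw [(bijective_halves hp).sum_comp (fun q : (Fin (p / 2) → Fin N) × (Fin (p / 2) → Fin N) =>
      (1 / 2 : ℂ) • (collective n q.1 q.2 * (collective n q.1 q.2)ᴴ
        + (collective n q.1 q.2)ᴴ * collective n q.1 q.2)), Fintype.sum_prod_type]
    simp only [conjTranspose_collective, ← Finset.smul_sum, Finset.sum_add_distrib]
    rw [Finset.sum_comm (f := fun a b => collective n b a * collective n a b), ← hW]
    module
  refine le_trans ?_ (sum_collective_le N n (p / 2))
  rw [← hW, ← h1]
  refine Finset.sum_le_sum fun μ _ => ?_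
  rw [hamiltonian_single]
  exact sq_half_add_conjTranspose_le _ hc

theorem symmetrize_add (S T : Tensor p N) :
    symmetrize (S + T) = symmetrize S + symmetrize T := by
  ext1 μ
  simp only [symmetrize, Pi.add_apply, Finset.sum_add_distrib, mul_add]

theorem symmetrize_smul (c : ℂ) (T : Tensor p N) : symmetrize (c • T) = c • symmetrize T := by
  ext1 μ
  simp only [symmetrize, Pi.smul_apply, smul_eq_mul, ← Finset.mul_sum]
  ring

theorem symmetrize_sum_smul {ι : Type*} [Fintype ι] (t : ι → Tensor p N) (x : ι → ℝ) :
    symmetrize (∑ k, (x k : ℂ) • t k) = ∑ k, (x k : ℂ) • symmetrize (t k) := by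
  let L : Tensor p N →ₗ[ℂ] Tensor p N :=
    { toFun := symmetrize
      map_add' := symmetrize_add
      map_smul' := symmetrize_smul }
  change L _ = ∑ k, (x k : ℂ) • L (t k)
  simp only [map_sum, map_smul]

theorem symmetrize_single (μ : Fin p → Fin N) (c : ℂ) :
    symmetrize (Pi.single μ c : Tensor p N)
      = ∑ π : Equiv.Perm (Fin p), (((p ! : ℝ)⁻¹ : ℝ) : ℂ) •
          (Pi.single (μ ∘ (π⁻¹ : Equiv.Perm (Fin p))) c : Tensor p N) := by
  ext1 ν
  simp only [symmetrize, Finset.sum_apply, Pi.smul_apply, smul_eq_mul, ← Finset.mul_sum]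
  push_cast
  congr 1
  refine Finset.sum_congr rfl fun π _ => ?_
  simp only [Pi.single_apply]
  refine if_congr ?_ rfl rfl
  rw [comp_perm_eq_iff, eq_comm]

/-- Symmetrizing the tensor does not increase the bound on the squares: the Hamiltonian of a
symmetrized unit tensor is an average of the Hamiltonians of unit tensors. -/
theorem sum_sq_hamiltonian_symmetrize_single_le (hp : Even p) (n : ℕ) {c : ℂ}
    (hc : c * star c = 1) :
    ∑ μ : Fin p → Fin N, hamiltonian n (symmetrize (Pi.single μ c : Tensor p N))
        * hamiltonian n (symmetrize (Pi.single μ c : Tensor p N))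
      ≤ (varianceBound N n (p / 2) : ℂ) • (1 : Operator N n) := by
  refine le_trans ?_ (sum_sq_hamiltonian_single_le hp n hc)
  set B : (Fin p → Fin N) → Operator N n := fun μ => hamiltonian n (Pi.single μ c : Tensor p N)
    with hB
  have hcard : (Fintype.card (Equiv.Perm (Fin p)) : ℂ) = (p ! : ℂ) := by
    rw [Fintype.card_perm, Fintype.card_fin]
  have h1 (μ : Fin p → Fin N) : hamiltonian n (symmetrize (Pi.single μ c : Tensor p N))
      = (p ! : ℂ)⁻¹ • ∑ π : Equiv.Perm (Fin p), B (μ ∘ (π⁻¹ : Equiv.Perm (Fin p))) := by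
    rw [symmetrize_single, hamiltonian_sum_smul n _ fun _ => (p ! : ℝ)⁻¹, series,
      Finset.smul_sum]
    push_cast
    rfl
  have h2 (μ : Fin p → Fin N) : hamiltonian n (symmetrize (Pi.single μ c : Tensor p N))
        * hamiltonian n (symmetrize (Pi.single μ c : Tensor p N))
      ≤ (p ! : ℂ)⁻¹ • ∑ π : Equiv.Perm (Fin p), B (μ ∘ (π⁻¹ : Equiv.Perm (Fin p)))
          * B (μ ∘ (π⁻¹ : Equiv.Perm (Fin p))) := by
    rw [h1, ← hcard]
    exact sq_average_le fun π => hamiltonian_isHermitian n _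
  refine (Finset.sum_le_sum fun μ _ => h2 μ).trans (le_of_eq ?_)
  rw [← Finset.smul_sum, Finset.sum_comm]
  have h3 (π : Equiv.Perm (Fin p)) : ∑ μ : Fin p → Fin N,
        B (μ ∘ (π⁻¹ : Equiv.Perm (Fin p))) * B (μ ∘ (π⁻¹ : Equiv.Perm (Fin p)))
      = ∑ μ, B μ * B μ :=
    Fintype.sum_equiv (permBasis N π) _ _ fun μ => rfl
  simp only [h3, Finset.sum_const, Finset.card_univ]
  rw [← Nat.cast_smul_eq_nsmul ℂ, hcard,
    inv_smul_smul₀ (Nat.cast_ne_zero.2 (Nat.factorial_ne_zero p))]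

end Hamiltonian

section Ensemble

open scoped ComplexOrder MatrixOrder

/-- The matrix series bound for a random tensor `∑ k, x k • t k` with independent Gaussian `x k`. -/
theorem integrable_trExp_and_integral_le {ι : Type*} [Fintype ι] {p N : ℕ} (n : ℕ) (v : ℝ≥0)
    (t : ι → Tensor p N) {w : ℝ} (hw0 : 0 ≤ w)
    (hw : ∑ k, hamiltonian n (t k) * hamiltonian n (t k) ≤ (w : ℂ) • (1 : Operator N n))
    (τ : ℝ) :
    Integrable (trExp n τ)
        ((Measure.pi fun _ : ι => gaussianReal 0 v).map fun x => ∑ k, (x k : ℂ) • t k) ∧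
      ∫ G, (trExp n τ G).re
          ∂((Measure.pi fun _ : ι => gaussianReal 0 v).map fun x => ∑ k, (x k : ℂ) • t k)
        ≤ symDim N n * Real.exp (τ ^ 2 * (v * w) / 2) := by
  have h := integral_trace_exp_series_le v symmetrizer_isHermitian symmetrizer_mul_self
    (fun k => hamiltonian_isHermitian n (t k))
    (fun k => commute_symmetrizer fun σ α β => hamiltonian_perm σ (t k) α β) hw0
    (Matrix.le_iff.1 hw) τ
  have hcont : Continuous (trExp n τ : Tensor p N → ℂ) := by
    have : (trExp n τ : Tensor p N → ℂ)
        = fun T => (symmetrizer N n * NormedSpace.exp ((τ : ℂ) • hamiltonian n T)).trace :=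
      funext fun T => trExp_eq_trace τ T
    rw [this]
    exact (continuous_trace_mul_exp _ _).comp (continuous_hamiltonian n)
  have hmeas : Measurable fun x : ι → ℝ => ∑ k, (x k : ℂ) • t k := by
    refine Continuous.measurable ?_
    fun_prop
  simp only [← hamiltonian_sum_smul, ← trExp_eq_trace, trace_symmetrizer, Complex.natCast_re] at h
  refine ⟨?_, ?_⟩
  · rw [integrable_map_measure hcont.aestronglyMeasurable hmeas.aemeasurable]
    exact h.1
  · have hre : Continuous fun T : Tensor p N => (trExp n τ T).re :=
      Complex.continuous_re.comp hcont
    rw [integral_map hmeas.aemeasurable hre.aestronglyMeasurable]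
    exact h.2

theorem measurable_symmetrize {p N : ℕ} : Measurable (symmetrize : Tensor p N → Tensor p N) := by
  unfold symmetrize
  fun_prop

theorem gaussianTensor_real (p N : ℕ) :
    gaussianTensor p N .real
      = (Measure.pi fun _ : Fin p → Fin N => gaussianReal 0 1).map
          fun x => ∑ μ, (x μ : ℂ) • (Pi.single μ 1 : Tensor p N) := by
  rw [gaussianTensor]
  congr 1
  ext x ν
  simp [Finset.sum_apply, Pi.single_apply]

theorem gaussianTensor_complex (p N : ℕ) :
    gaussianTensor p N .complex
      = (Measure.pi fun _ : (Fin p → Fin N) ⊕ (Fin p → Fin N) => gaussianReal 0 (1 / 2)).map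
          fun x => ∑ k, (x k : ℂ) • (Sum.elim (fun μ => Pi.single μ 1)
            (fun μ => Pi.single μ Complex.I) k : Tensor p N) := by
  have h1 := measurePreserving_sumPiEquivProdPi
    fun _ : (Fin p → Fin N) ⊕ (Fin p → Fin N) => gaussianReal 0 (1 / 2)
  have h2 := (measurePreserving_arrowProdEquivProdArrow ℝ ℝ (Fin p → Fin N)
    (fun _ => gaussianReal 0 (1 / 2)) (fun _ => gaussianReal 0 (1 / 2))).symm
  have h3 := h2.comp h1
  rw [gaussianTensor, ← h3.map_eq, Measure.map_map _ h3.measurable]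
  · congr 1
    ext x ν
    simp only [Function.comp_apply, Fintype.sum_sum_type, Sum.elim_inl, Sum.elim_inr,
      Finset.sum_apply, Pi.smul_apply, Pi.single_apply, smul_eq_mul, mul_ite,
      mul_one, mul_zero, Finset.sum_ite_eq, Finset.mem_univ, if_true]
    exact Complex.mk_eq_add_mul_I _ _
  · exact measurable_pi_lambda _ fun μ =>
      Complex.measurableEquivRealProd.symm.measurable.comp (measurable_pi_apply μ)

theorem map_symmetrize_map {ι : Type*} [Fintype ι] {p N : ℕ} (γ : Measure (ι → ℝ))
    (t : ι → Tensor p N) :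
    (γ.map fun x => ∑ k, (x k : ℂ) • t k).map symmetrize
      = γ.map fun x => ∑ k, (x k : ℂ) • symmetrize (t k) := by
  have hmeas : Measurable fun x : ι → ℝ => ∑ k, (x k : ℂ) • t k := by
    refine Continuous.measurable ?_
    fun_prop
  rw [Measure.map_map measurable_symmetrize hmeas]
  congr 1
  ext1 x
  exact symmetrize_sum_smul t x

/-- Each ensemble is a Gaussian series. In the complex case the real and the imaginary parts of the
entries both contribute `varianceBound` to the sum of squares, and their variance is `1 / 2`; the
factor `2` of the complex ensemble is therefore not used up. -/
theorem exists_ensemble_eq_map {p : ℕ} (hp : Even p) (N : ℕ) (κ : EntryField) (sym : Bool) :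
    ∃ (ι : Type) (_ : Fintype ι) (v : ℝ≥0) (t : ι → Tensor p N),
      ensemble p N κ sym
          = (Measure.pi fun _ : ι => gaussianReal 0 v).map (fun x => ∑ k, (x k : ℂ) • t k) ∧
        ∀ n : ℕ, ∃ w : ℝ, 0 ≤ w ∧ v * w ≤ κ.factor * varianceBound N n (p / 2) ∧
          ∑ k, hamiltonian n (t k) * hamiltonian n (t k) ≤ (w : ℂ) • (1 : Operator N n) := by
  have h1 : (1 : ℂ) * star (1 : ℂ) = 1 := by simp
  have hI : Complex.I * star Complex.I = 1 := by simp
  have hv (n : ℕ) := varianceBound_nonneg N n (p / 2)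
  cases κ with
  | real =>
    cases sym with
    | false =>
      refine ⟨_, inferInstance, 1, _, gaussianTensor_real p N, fun n =>
        ⟨varianceBound N n (p / 2), hv n, by simp [EntryField.factor], ?_⟩⟩
      exact sum_sq_hamiltonian_single_le hp n h1
    | true =>
      refine ⟨_, inferInstance, 1, fun μ => symmetrize (Pi.single μ 1), ?_, fun n =>
        ⟨varianceBound N n (p / 2), hv n, by simp [EntryField.factor], ?_⟩⟩
      · rw [ensemble, if_pos rfl, gaussianTensor_real, map_symmetrize_map]
      · exact sum_sq_hamiltonian_symmetrize_single_le hp n h1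
  | complex =>
    have hle (n : ℕ) : ((1 / 2 : ℝ≥0) : ℝ) * (2 * varianceBound N n (p / 2))
        ≤ EntryField.complex.factor * varianceBound N n (p / 2) := by
      have := hv n
      simp only [EntryField.factor]
      push_cast
      linarith
    cases sym with
    | false =>
      refine ⟨_, inferInstance, 1 / 2, _, gaussianTensor_complex p N, fun n =>
        ⟨2 * varianceBound N n (p / 2), by linarith [hv n], hle n, ?_⟩⟩
      rw [Fintype.sum_sum_type]
      refine (add_le_add (sum_sq_hamiltonian_single_le hp n h1)
        (sum_sq_hamiltonian_single_le hp n hI)).trans_eq ?_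
      push_cast
      module
    | true =>
      refine ⟨_, inferInstance, 1 / 2, fun k => symmetrize (Sum.elim (fun μ => Pi.single μ 1)
            (fun μ => Pi.single μ Complex.I) k : Tensor p N), ?_, fun n =>
        ⟨2 * varianceBound N n (p / 2), by linarith [hv n], hle n, ?_⟩⟩
      · rw [ensemble, if_pos rfl, gaussianTensor_complex, map_symmetrize_map]
      · rw [Fintype.sum_sum_type]
        refine (add_le_add (sum_sq_hamiltonian_symmetrize_single_le hp n h1)
          (sum_sq_hamiltonian_symmetrize_single_le hp n hI)).trans_eq ?_
        push_cast
        module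

end Ensemble

/-! ### Asymptotics of the constant -/

section Asymptotics

theorem leadingJ_eq (p n : ℕ) :
    leadingJ p n = (n.descFactorial (p / 2) : ℝ) / (n : ℝ) ^ (p / 2) := by
  rw [leadingJ, Nat.descFactorial_eq_factorial_mul_choose]
  push_cast
  rfl

theorem tendsto_leadingJ (p : ℕ) : Tendsto (leadingJ p) atTop (𝓝 1) := by
  have h := (isEquivalent_iff_tendsto_one (by
    filter_upwards [eventually_gt_atTop 0] with n hn
    positivity)).1 (isEquivalent_descFactorial (p / 2))
  refine h.congr fun n => ?_
  rw [leadingJ_eq]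
  rfl

/-- The constant `J` of the trace bound, `varianceBound` in units of `n ^ (p / 2) * N ^ (p / 2)`. -/
noncomputable def boundJ (κ : EntryField) (p N n : ℕ) : ℝ :=
  κ.factor * varianceBound N n (p / 2) / ((n : ℝ) ^ (p / 2) * (N : ℝ) ^ (p / 2))

theorem EntryField.factor_nonneg (κ : EntryField) : 0 ≤ κ.factor := by
  cases κ <;> simp [EntryField.factor]

theorem abs_boundJ_sub_leadingJ_le (κ : EntryField) {p N n : ℕ} (hp : 0 < p / 2) (hN : 1 ≤ N)
    (hn : 1 ≤ n) :
    |boundJ κ p N n - κ.factor * leadingJ p n| ≤ κ.factor * ((n : ℝ) ^ (p / 2) * (N : ℝ)⁻¹) := by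
  obtain ⟨k, hk⟩ : ∃ k, p / 2 = k + 1 := ⟨p / 2 - 1, by omega⟩
  have hN' : (0 : ℝ) < N := by exact_mod_cast hN
  have hn' : (0 : ℝ) < n := by exact_mod_cast hn
  have hd : (n.descFactorial (p / 2) : ℝ) ≤ (n : ℝ) ^ (p / 2) := by
    exact_mod_cast Nat.descFactorial_le_pow n (p / 2)
  have e : boundJ κ p N n - κ.factor * leadingJ p n
      = κ.factor * ((n.descFactorial (p / 2) : ℝ) ^ 2 / (n : ℝ) ^ (p / 2) * (N : ℝ)⁻¹) := by
    rw [boundJ, leadingJ_eq, varianceBound, hk, Nat.add_sub_cancel]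
    field_simp
    ring
  have hκ := κ.factor_nonneg
  rw [e, abs_of_nonneg (by positivity)]
  gcongr
  rw [div_le_iff₀ (by positivity), ← sq]
  gcongr

theorem tendsto_boundJ_sub_leadingJ (κ : EntryField) {p : ℕ} (hp : 0 < p / 2) {n : ℕ → ℕ}
    (hn : ∀ N, 1 ≤ n N)
    (hO : (fun N : ℕ => (n N : ℝ)) =O[atTop] fun N : ℕ => (N : ℝ) ^ (1 / (2 * (p / 2 : ℕ)) : ℝ)) :
    Tendsto (fun N : ℕ => boundJ κ p N (n N) - κ.factor * leadingJ p (n N)) atTop (𝓝 0) := by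
  have h1 : (fun N : ℕ => boundJ κ p N (n N) - κ.factor * leadingJ p (n N))
      =O[atTop] fun N : ℕ => (n N : ℝ) ^ (p / 2) * (N : ℝ)⁻¹ := by
    refine IsBigO.of_bound κ.factor ?_
    filter_upwards [eventually_ge_atTop 1] with N hN
    rw [Real.norm_eq_abs, Real.norm_of_nonneg (by positivity)]
    exact abs_boundJ_sub_leadingJ_le κ hp hN (hn N)
  have h2 : (fun N : ℕ => (n N : ℝ) ^ (p / 2) * (N : ℝ)⁻¹)
      =O[atTop] fun N : ℕ => (N : ℝ) ^ (-(1 / 2) : ℝ) := by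
    refine ((hO.pow (p / 2)).mul (isBigO_refl (fun N : ℕ => (N : ℝ)⁻¹) atTop)).congr'
      EventuallyEq.rfl ?_
    filter_upwards [eventually_ge_atTop 1] with N hN
    have hN' : (0 : ℝ) < N := by exact_mod_cast hN
    have hp' : ((p / 2 : ℕ) : ℝ) ≠ 0 := by exact_mod_cast hp.ne'
    rw [← Real.rpow_mul_natCast hN'.le, ← Real.rpow_neg_one, ← Real.rpow_add hN']
    congr 1
    field_simp
    norm_num
  exact (h1.trans h2).trans_tendsto
    ((tendsto_rpow_neg_atTop (by norm_num : (0 : ℝ) < 1 / 2)).comp tendsto_natCast_atTop_atTop)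

end Asymptotics

end SpikedTensor

theorem mainTheorem2 (p : ℕ) (hp : Even p) (hp0 : 0 < p) :
    ∃ θ : ℝ, 0 < θ ∧
      ∀ (κ : SpikedTensor.EntryField) (sym : Bool),
        ∃ J : ℕ → ℕ → ℝ,
          (∀ N n : ℕ, 1 ≤ N → 1 ≤ n → ∀ τ : ℝ,
            Integrable (SpikedTensor.trExp n τ) (SpikedTensor.ensemble p N κ sym) ∧
            SpikedTensor.Z κ sym τ p N n ≤
              (SpikedTensor.symDim N n : ℝ) *
                Real.exp (τ ^ 2 * (J N n / 2) * (n : ℝ) ^ (p / 2) * (N : ℝ) ^ (p / 2))) ∧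
          (∀ n : ℕ → ℕ, (∀ N, 1 ≤ n N) →
            (fun N : ℕ => (n N : ℝ)) =O[atTop] (fun N : ℕ => (N : ℝ) ^ θ) →
            ((fun N : ℕ => J N (n N) - κ.factor * SpikedTensor.leadingJ p (n N))
                =o[atTop] (fun _ : ℕ => (1 : ℝ))) ∧
            (Tendsto n atTop atTop →
              Tendsto (fun N : ℕ => J N (n N)) atTop (𝓝 κ.factor))) := by
  have hk : 0 < p / 2 := by
    obtain ⟨k, rfl⟩ := hp
    omega
  -- With this exponent, `n ^ (p / 2) / N` is `O(N ^ (-1 / 2))`.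
  refine ⟨1 / (2 * (p / 2 : ℕ)), by positivity, fun κ sym =>
    ⟨SpikedTensor.boundJ κ p, fun N n hN hn τ => ?_, fun n hn hO => ?_⟩⟩
  · obtain ⟨ι, _, v, t, hens, ht⟩ := SpikedTensor.exists_ensemble_eq_map hp N κ sym
    obtain ⟨w, hw0, hvw, hw⟩ := ht n
    have h := SpikedTensor.integrable_trExp_and_integral_le n v t hw0 hw τ
    rw [← hens] at h
    refine ⟨h.1, h.2.trans (mul_le_mul_of_nonneg_left (Real.exp_le_exp.2 ?_) (Nat.cast_nonneg _))⟩
    have hN' : (0 : ℝ) < N := by exact_mod_cast hN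
    have hn' : (0 : ℝ) < n := by exact_mod_cast hn
    have e : τ ^ 2 * (SpikedTensor.boundJ κ p N n / 2) * (n : ℝ) ^ (p / 2) * (N : ℝ) ^ (p / 2)
        = τ ^ 2 * (κ.factor * SpikedTensor.varianceBound N n (p / 2)) / 2 := by
      rw [SpikedTensor.boundJ]
      field_simp
    rw [e]
    gcongr
  · have h := SpikedTensor.tendsto_boundJ_sub_leadingJ κ hk hn hO
    refine ⟨(isLittleO_one_iff ℝ).2 h, fun hlim => ?_⟩
    have h2 := h.add (((SpikedTensor.tendsto_leadingJ p).comp hlim).const_mul κ.factor)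
    simpa using h2
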